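/- Setting. Consider a finite two-player zero-sum extensive-form game with chance moves and perfect recall. $H$ is the set of histories, $Z\subseteq H$ the set of terminal histories, $u_1=-u_2$ are the payoffs on $Z$, $A(I)$ is the set of actions available at an information set $I$, and $P(I)$ is the player acting there. Perfect recall means that, for every strategy profile $\sigma$ and every information set $I$ of player $i$, the probability $\pi_i^\sigma(h)$ contributed by player $i$ to reaching $h$ is the same for all $h\in I$; it is denoted $\pi_i^\sigma(I)$. Let $\pi_{-i}^\sigma(h)$ be the contribution of the opponent and chance to the probability of reaching $h$, and $\pi^\sigma(h,z)$ the probability of reaching $z$ from $h$ ($0$ if $h$ is not an initial segment of $z$). For $i=P(I)$ and $a\in A(I)$ put $$v^\sigma(I)=\sum_{h\in I}\pi^\sigma_{-i}(h)\sum_{z\in Z}\pi^\sigma(h,z)u_i(z),\qquad v^\sigma(I,a)=\sum_{h\in I}\pi^\sigma_{-i}(h)\sum_{z\in Z}\pi^\sigma(h\cdot a,z)u_i(z).$$ A counterfactual best response (CBR) of player $i$ to $\sigma_{-i}$ is a strategy $c$ of player $i$ such that, at every information set $J$ of player $i$, $c(J,b)>0$ implies $v^{\langle c,\sigma_{-i}\rangle}(J,b)=\max_{b'\in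 A(J)}v^{\langle c,\sigma_{-i}\rangle}(J,b')$. Put $CBV^{\sigma_{-i}}(I)=v^{\langle c,\sigma_{-i}\rangle}(I)$ and $CBV^{\sigma_{-i}}(I,a)=v^{\langle c,\sigma_{-i}\rangle}(I,a)$ for such a $c$. CFR (with regret matching) plays profiles $\sigma^1,\sigma^2,\dots$: with $R^T(I,a)=\sum_{t=1}^T\big(v^{\sigma^t}(I,a)-v^{\sigma^t}(I)\big)$ and $R^T_+=\max\{R^T,0\}$, for $T\ge 0$ the probability $\sigma^{T+1}(I,a)$ is $R^T_+(I,a)/\sum_{b\in A(I)}R^T_+(I,b)$ if this denominator is positive, and $1/|A(I)|$ otherwise. The average strategy of player $i$ is $\bar\sigma_i^T(I)=\sum_{t=1}^T\pi_i^{\sigma^t}(I)\sigma_i^t(I)\big/\sum_{t=1}^T\pi_i^{\sigma^t}(I)$ (uniform where the denominator is $0$). For $x=(x_J)_J$ with all $x_J\ge 0$, a $T$-near CBR of player $i$ to $\sigma_{-i}$ with tolerances $x$ is a strategy $c$ of player $i$ with $\sum_{b\in A(J)}\max\{v^{\langle c,\sigma_{-i}\rangle}(J,b)-v^{\langle c,\sigma_{-i}\rangle}(J),0\}^2\le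 x_J/T^2$ at every information set $J$ of player $i$, and $NBV^{\sigma_{-i},T}(I,a)$ is the infimum of $v^{\langle c,\sigma_{-i}\rangle}(I,a)$ over all these $c$. Theorem. Let $I$ be an information set, $i=P(I)$ and $a\in A(I)$. Suppose that $CBV^{\sigma^*_{-i}}(I,a)<CBV^{\sigma^*_{-i}}(I)$ for every opponent Nash equilibrium strategy $\sigma^*_{-i}$ (that is, every strategy of the opponent that is part of some Nash equilibrium). Then there exist $T_{I,a}$ and $\delta_{I,a}>0$ such that for every $T\ge T_{I,a}$, after $T$ iterations of CFR, $$CBV^{\bar\sigma^T_{-i}}(I,a)-\frac{\sum_{t=1}^T v^{\sigma^t}(I)}{T}\le-\delta_{I,a},$$ and consequently the condition under which Total RBP may prune $a$ at $I$ holds, whatever the tolerances $x_J\ge 0$ are: $$T\cdot NBV^{\bar\sigma^T_{-i},T}(I,a)\le\sum_{t=1}^T v^{\sigma^t}(I).$$ -/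

import Mathlib

set_option linter.unusedSectionVars false

/-- A finite two-player extensive-form game with chance moves and imperfect information.
Histories are finite sequences of actions from `A`; the labels in `ι` name the information sets
of both players. -/
structure EFGame (A ι : Type*) [Fintype A] [DecidableEq A] where
  /-- the set `H` of all histories -/
  H : Finset (List A)
  nil_mem : [] ∈ H
  prefix_mem : ∀ (h : List A) (a : A), h ++ [a] ∈ H → h ∈ H
  /-- `infoset h = some I` says that `h` is a decision history lying in the information set `I`;
  a non-terminal history `h ∈ H` with `infoset h = none` is a chance history. -/
  infoset : List A → Option ι
  /-- the player who acts at an information set -/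
  owner : ι → Fin 2
  /-- the actions `A(I)` available at an information set -/
  act : ι → Finset A
  act_nonempty : ∀ I, (act I).Nonempty
  infoset_mem : ∀ h I, infoset h = some I → h ∈ H
  /-- all histories of an information set have the same available actions -/
  infoset_act : ∀ h I, infoset h = some I → ∀ a, a ∈ act I ↔ h ++ [a] ∈ H
  infoset_nonempty : ∀ I, ∃ h, infoset h = some I
  /-- the fixed probability with which chance plays an action -/
  chance : List A → A → ℝ
  chance_nonneg : ∀ h a, h ++ [a] ∈ H → infoset h = none → 0 ≤ chance h a
  chance_sum : ∀ h ∈ H, infoset h = none → (∃ a, h ++ [a] ∈ H) →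
    ∑ a with h ++ [a] ∈ H, chance h a = 1
  /-- the payoff `u_i(z)` of player `i` at the terminal history `z` -/
  payoff : Fin 2 → List A → ℝ

namespace EFGame

variable {A ι : Type*} [Fintype A] [DecidableEq A]

/-- Terminal histories: no action is available. -/
def terminals (G : EFGame A ι) : Finset (List A) :=
  {z ∈ G.H | ∀ a : A, z ++ [a] ∉ G.H}

/-- The histories belonging to an information set. -/
def nodes [DecidableEq ι] (G : EFGame A ι) (I : ι) : Finset (List A) :=
  {h ∈ G.H | G.infoset h = some I}

/-- Zero-sum: `u_1 = -u_2`. -/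
def ZeroSum (G : EFGame A ι) : Prop :=
  ∀ z ∈ G.terminals, G.payoff 0 z = -G.payoff 1 z

/-- The other player. -/
def opponent (i : Fin 2) : Fin 2 := 1 - i

/-- A strategy profile: a probability vector over `A(I)` for every information set `I` of
either player. The strategy `σ_i` of player `i` is the part of `σ` on the information sets
owned by `i`. -/
def IsProfile (G : EFGame A ι) (σ : ι → A → ℝ) : Prop :=
  ∀ I, (∀ a, 0 ≤ σ I a) ∧ (∀ a, a ∉ G.act I → σ I a = 0) ∧ ∑ a ∈ G.act I, σ I a = 1

/-- The profile `⟨τ_i, σ_{-i}⟩`. -/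
def combine (G : EFGame A ι) (i : Fin 2) (τ σ : ι → A → ℝ) : ι → A → ℝ :=
  fun I => if G.owner I = i then τ I else σ I

/-- Product of the weights `w g b` over the moves made when the moves of the second list are
played one after the other from the history given by the first list. -/
def pathProd (w : List A → A → ℝ) : List A → List A → ℝ
  | _, [] => 1
  | g, b :: s => w g b * pathProd w (g ++ [b]) s

/-- Probability of the move `b` at the history `g` under `σ` (and chance). -/
def moveProb (G : EFGame A ι) (σ : ι → A → ℝ) (g : List A) (b : A) : ℝ :=
  match G.infoset g with
  | some I => σ I b
  | none => G.chance g b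

/-- The factor of player `i` in `moveProb`. -/
def ownProb (G : EFGame A ι) (σ : ι → A → ℝ) (i : Fin 2) (g : List A) (b : A) : ℝ :=
  match G.infoset g with
  | some I => if G.owner I = i then σ I b else 1
  | none => 1

/-- The factor of everybody except player `i` (opponent and chance) in `moveProb`. -/
def otherProb (G : EFGame A ι) (σ : ι → A → ℝ) (i : Fin 2) (g : List A) (b : A) : ℝ :=
  match G.infoset g with
  | some I => if G.owner I = i then 1 else σ I b
  | none => G.chance g b

/-- `π^σ(h)`. -/
def reach (G : EFGame A ι) (σ : ι → A → ℝ) (h : List A) : ℝ :=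
  pathProd (G.moveProb σ) [] h

/-- `π_i^σ(h)`. -/
def reachOwn (G : EFGame A ι) (σ : ι → A → ℝ) (i : Fin 2) (h : List A) : ℝ :=
  pathProd (G.ownProb σ i) [] h

/-- `π_{-i}^σ(h)`. -/
def reachOther (G : EFGame A ι) (σ : ι → A → ℝ) (i : Fin 2) (h : List A) : ℝ :=
  pathProd (G.otherProb σ i) [] h

/-- `π^σ(h, h')`: the probability of reaching `h'` from `h`, and `0` if `h` is not an initial
segment of `h'`. -/
def reachFrom (G : EFGame A ι) (σ : ι → A → ℝ) (h h' : List A) : ℝ :=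
  if h <+: h' then pathProd (G.moveProb σ) h (h'.drop h.length) else 0

/-- Perfect recall: the histories of an information set of player `i` all have the same
`π_i`, whatever the strategies are. -/
def PerfectRecall (G : EFGame A ι) : Prop :=
  ∀ σ, G.IsProfile σ → ∀ (I : ι) (h h' : List A),
    G.infoset h = some I → G.infoset h' = some I →
      G.reachOwn σ (G.owner I) h = G.reachOwn σ (G.owner I) h'

/-- `π_i^σ(I)` for `i` the owner of `I`: the value `π_i^σ(h)` at an `h ∈ I` (under perfect recall
the choice of `h` does not matter). -/
noncomputable def reachInfo (G : EFGame A ι) (σ : ι → A → ℝ) (I : ι) : ℝ :=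
  G.reachOwn σ (G.owner I) (G.infoset_nonempty I).choose

/-- Expected payoff `u_i(σ)`. -/
def utility (G : EFGame A ι) (i : Fin 2) (σ : ι → A → ℝ) : ℝ :=
  ∑ z ∈ G.terminals, G.reach σ z * G.payoff i z

/-- `σ` is a Nash equilibrium: each player's strategy is a best response. -/
def IsNash (G : EFGame A ι) (σ : ι → A → ℝ) : Prop :=
  G.IsProfile σ ∧ ∀ i, ∀ τ, G.IsProfile τ → G.utility i (G.combine i τ σ) ≤ G.utility i σ

/-- The strategy `σ_j` of player `j` is a Nash equilibrium strategy: it is the `j`-part of some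
Nash equilibrium. -/
def IsNashStrategy (G : EFGame A ι) (j : Fin 2) (σ : ι → A → ℝ) : Prop :=
  ∃ τ, G.IsNash τ ∧ ∀ I, G.owner I = j → τ I = σ I

variable [DecidableEq ι]

/-- Counterfactual value `v^σ(I)`. -/
def cfv (G : EFGame A ι) (σ : ι → A → ℝ) (I : ι) : ℝ :=
  ∑ h ∈ G.nodes I, G.reachOther σ (G.owner I) h *
    ∑ z ∈ G.terminals, G.reachFrom σ h z * G.payoff (G.owner I) z

/-- Counterfactual value `v^σ(I, a)` of an action. -/
def cfvAct (G : EFGame A ι) (σ : ι → A → ℝ) (I : ι) (a : A) : ℝ :=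
  ∑ h ∈ G.nodes I, G.reachOther σ (G.owner I) h *
    ∑ z ∈ G.terminals, G.reachFrom σ (h ++ [a]) z * G.payoff (G.owner I) z

/-- `c_i` is a counterfactual best response to `σ_{-i}`: at every information set of player `i`,
reached or not, it only plays actions of maximal counterfactual value. -/
def IsCBR (G : EFGame A ι) (i : Fin 2) (σ c : ι → A → ℝ) : Prop :=
  G.IsProfile c ∧ ∀ I, G.owner I = i → ∀ a ∈ G.act I, 0 < c I a →
    ∀ a' ∈ G.act I, G.cfvAct (G.combine i c σ) I a' ≤ G.cfvAct (G.combine i c σ) I a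

/-! Existence of counterfactual best responses. -/

theorem pathProd_append (w : List A → A → ℝ) (s : List A) : ∀ (g s' : List A),
    pathProd w g (s ++ s') = pathProd w g s * pathProd w (g ++ s) s' := by
  induction s with
  | nil => intro g s'; simp [pathProd]
  | cons b s ih => intro g s'; simp [pathProd, ih, mul_assoc]

theorem pathProd_congr (w w' : List A → A → ℝ) (s : List A) : ∀ g : List A,
    (∀ s₁ b, w (g ++ s₁) b = w' (g ++ s₁) b) → pathProd w g s = pathProd w' g s := by
  induction s with
  | nil => intro g _; rfl
  | cons b s ih =>
    intro g hw
    have h1 := hw [] b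
    rw [List.append_nil] at h1
    rw [pathProd, pathProd, h1, ih]
    intro s₁ b'
    simpa using hw (b :: s₁) b'

/-- The uniform profile. -/
noncomputable def uniformProfile (G : EFGame A ι) : ι → A → ℝ := fun I a =>
  if a ∈ G.act I then 1 / ((G.act I).card : ℝ) else 0

theorem uniformProfile_nonneg (G : EFGame A ι) (I : ι) (a : A) : 0 ≤ G.uniformProfile I a := by
  unfold uniformProfile; split_ifs <;> positivity

theorem isProfile_uniformProfile (G : EFGame A ι) : G.IsProfile G.uniformProfile := by
  intro I
  refine ⟨G.uniformProfile_nonneg I, fun a ha => by simp [uniformProfile, ha], ?_⟩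
  have hc : ((G.act I).card : ℝ) ≠ 0 := by
    exact_mod_cast (G.act_nonempty I).card_pos.ne'
  rw [Finset.sum_congr rfl (g := fun _ => 1 / ((G.act I).card : ℝ))
    (fun a ha => by simp [uniformProfile, ha])]
  simp [hc]

theorem uniformProfile_le_one (G : EFGame A ι) (I : ι) (a : A) : G.uniformProfile I a ≤ 1 := by
  unfold uniformProfile
  split_ifs
  · have h1 : (1 : ℝ) ≤ ((G.act I).card : ℝ) := by exact_mod_cast (G.act_nonempty I).card_pos
    exact (div_le_one (by linarith)).2 h1
  · exact zero_le_one

theorem ownProb_uniform_mem (G : EFGame A ι) (i : Fin 2) (g : List A) (b : A) :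
    0 ≤ G.ownProb G.uniformProfile i g b ∧ G.ownProb G.uniformProfile i g b ≤ 1 := by
  unfold ownProb
  split
  · split_ifs
    · exact ⟨G.uniformProfile_nonneg _ _, G.uniformProfile_le_one _ _⟩
    · exact ⟨zero_le_one, le_rfl⟩
  · exact ⟨zero_le_one, le_rfl⟩

theorem pathProd_uniform_mem (G : EFGame A ι) (i : Fin 2) (s : List A) : ∀ g : List A,
    0 ≤ pathProd (G.ownProb G.uniformProfile i) g s ∧
      pathProd (G.ownProb G.uniformProfile i) g s ≤ 1 := by
  induction s with
  | nil => intro g; simp [pathProd]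
  | cons b s ih =>
    intro g
    have h1 := G.ownProb_uniform_mem i g b
    have h2 := ih (g ++ [b])
    exact ⟨mul_nonneg h1.1 h2.1, mul_le_one₀ h1.2 h2.1 h2.2⟩

theorem reachOwn_uniform_pos (G : EFGame A ι) (i : Fin 2) (h : List A) :
    h ∈ G.H → 0 < G.reachOwn G.uniformProfile i h := by
  induction h using List.reverseRecOn with
  | nil => intro _; simp [reachOwn, pathProd]
  | append_singleton h b ih =>
    intro hb
    have h0 := ih (G.prefix_mem h b hb)
    rw [reachOwn, pathProd_append]
    refine mul_pos h0 ?_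
    simp only [List.nil_append, pathProd, mul_one, ownProb]
    split
    · rename_i I hI
      split_ifs
      · have hm := (G.infoset_act h I hI b).2 hb
        have := (G.act_nonempty I).card_pos
        simp only [uniformProfile, hm, if_true]
        positivity
      · exact one_pos
    · exact one_pos

theorem reachOwn_uniform_lt (G : EFGame A ι) (I : ι) (h : List A) (hI : G.infoset h = some I)
    (hcard : 2 ≤ (G.act I).card) (a : A) (s : List A) :
    G.reachOwn G.uniformProfile (G.owner I) (h ++ [a] ++ s)
      < G.reachOwn G.uniformProfile (G.owner I) h := by
  have hpos := G.reachOwn_uniform_pos (G.owner I) h (G.infoset_mem h I hI)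
  have h1 : G.ownProb G.uniformProfile (G.owner I) h a < 1 := by
    simp only [ownProb, hI, if_true, uniformProfile]
    split_ifs
    · have : (2 : ℝ) ≤ ((G.act I).card : ℝ) := by exact_mod_cast hcard
      rw [div_lt_one (by linarith)]
      linarith
    · exact one_pos
  have h0 := (G.ownProb_uniform_mem (G.owner I) h a).1
  have h2 := G.pathProd_uniform_mem (G.owner I) s (h ++ [a])
  have h3 : G.reachOwn G.uniformProfile (G.owner I) (h ++ [a] ++ s)
      = G.reachOwn G.uniformProfile (G.owner I) h *
        (G.ownProb G.uniformProfile (G.owner I) h a *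
          pathProd (G.ownProb G.uniformProfile (G.owner I)) (h ++ [a]) s) := by
    simp [reachOwn, pathProd_append, pathProd]
  rw [h3]
  have h4 := mul_le_mul_of_nonneg_left h2.2 h0
  nlinarith

theorem reachInfo_eq (G : EFGame A ι) (hr : G.PerfectRecall) (σ : ι → A → ℝ) (hσ : G.IsProfile σ)
    (I : ι) (h : List A) (hI : G.infoset h = some I) :
    G.reachInfo σ I = G.reachOwn σ (G.owner I) h :=
  hr σ hσ I _ _ (G.infoset_nonempty I).choose_spec hI

/-- `v(I, a)` only depends on the owner's strategy at later information sets. -/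
theorem cfvAct_congr (G : EFGame A ι) (hr : G.PerfectRecall) (σ c c' : ι → A → ℝ) (I : ι)
    (hcard : 2 ≤ (G.act I).card)
    (hc : ∀ J, G.owner J = G.owner I →
      G.reachInfo G.uniformProfile J < G.reachInfo G.uniformProfile I → c J = c' J) (a : A) :
    G.cfvAct (G.combine (G.owner I) c σ) I a = G.cfvAct (G.combine (G.owner I) c' σ) I a := by
  have hother : G.otherProb (G.combine (G.owner I) c σ) (G.owner I)
      = G.otherProb (G.combine (G.owner I) c' σ) (G.owner I) := by
    funext g b
    unfold otherProb combine
    split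
    · split_ifs <;> rfl
    · rfl
  unfold cfvAct reachOther
  rw [hother]
  refine Finset.sum_congr rfl fun h hh => ?_
  have hI : G.infoset h = some I := (Finset.mem_filter.1 hh).2
  congr 1
  refine Finset.sum_congr rfl fun z _ => ?_
  congr 1
  unfold reachFrom
  split_ifs
  · refine pathProd_congr _ _ _ _ fun s b => ?_
    unfold moveProb combine
    split
    · rename_i J hJ
      by_cases ho : G.owner J = G.owner I
      · rw [if_pos ho, if_pos ho, hc J ho]
        rw [G.reachInfo_eq hr _ G.isProfile_uniformProfile J _ hJ,
          G.reachInfo_eq hr _ G.isProfile_uniformProfile I _ hI, ho]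
        exact G.reachOwn_uniform_lt I h hI hcard a s
      · rw [if_neg ho, if_neg ho]
    · rfl
  · rfl

theorem exists_isCBR (G : EFGame A ι) (hr : G.PerfectRecall) (i : Fin 2) (σ : ι → A → ℝ) :
    ∃ c, G.IsCBR i σ c := by
  have hfin : Finite ι := by
    refine Finite.of_injective (β := G.H) (fun I => ⟨(G.infoset_nonempty I).choose,
      G.infoset_mem _ I (G.infoset_nonempty I).choose_spec⟩) fun I J hIJ => ?_
    have h1 := (G.infoset_nonempty I).choose_spec
    rw [Subtype.mk.inj hIJ, (G.infoset_nonempty J).choose_spec] at h1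
    exact (Option.some.inj h1).symm
  have := Fintype.ofFinite ι
  suffices hs : ∀ s : Finset ι, ∃ c, G.IsProfile c ∧ ∀ I ∈ s, G.owner I = i →
      ∀ a ∈ G.act I, 0 < c I a → ∀ a' ∈ G.act I,
        G.cfvAct (G.combine i c σ) I a' ≤ G.cfvAct (G.combine i c σ) I a by
    obtain ⟨c, hc, h⟩ := hs Finset.univ
    exact ⟨c, hc, fun I => h I (Finset.mem_univ I)⟩
  intro s
  induction s using Finset.induction_on_max_value (G.reachInfo G.uniformProfile) with
  | empty => exact ⟨_, G.isProfile_uniformProfile, by simp⟩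
  | insert J s hJs hmax ih =>
    obtain ⟨c, hc, hopt⟩ := ih
    by_cases hJ : 2 ≤ (G.act J).card ∧ G.owner J = i
    · obtain ⟨hcard, hJi⟩ := hJ
      subst hJi
      obtain ⟨b, hb, hbmax⟩ := Finset.exists_max_image (G.act J)
        (G.cfvAct (G.combine (G.owner J) c σ) J) (G.act_nonempty J)
      let c' : ι → A → ℝ := Function.update c J (fun a => if a = b then 1 else 0)
      have hne : ∀ K, K ≠ J → c' K = c K := fun K hK => Function.update_of_ne hK _ _
      have hcJ : c' J = fun a => if a = b then 1 else 0 := Function.update_self _ _ _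
      have heq : ∀ K, 2 ≤ (G.act K).card → G.owner K = G.owner J →
          G.reachInfo G.uniformProfile K ≤ G.reachInfo G.uniformProfile J → ∀ a,
          G.cfvAct (G.combine (G.owner J) c' σ) K a
            = G.cfvAct (G.combine (G.owner J) c σ) K a := by
        intro K hK hKJ hle a
        rw [← hKJ]
        refine G.cfvAct_congr hr σ c' c K hK (fun L _ hlt => hne L ?_) a
        rintro rfl
        exact absurd hle (not_le.2 hlt)
      refine ⟨c', fun K => ?_, ?_⟩
      · by_cases hK : K = J
        · subst hK
          rw [hcJ]
          refine ⟨fun a => by dsimp only; split_ifs <;> norm_num, fun a ha => ?_, ?_⟩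
          · have : a ≠ b := fun h => ha (h ▸ hb)
            simp [this]
          · simp [hb]
        · rw [hne K hK]
          exact hc K
      · intro K hK hKi a ha hpos a' ha'
        by_cases hKJ : K = J
        · subst hKJ
          rw [heq K hcard rfl le_rfl, heq K hcard rfl le_rfl]
          have hab : a = b := by
            by_contra hab
            simp [hcJ, hab] at hpos
          rw [hab]
          exact hbmax a' ha'
        · have hKs : K ∈ s := (Finset.mem_insert.1 hK).resolve_left hKJ
          by_cases hKc : 2 ≤ (G.act K).card
          · rw [heq K hKc hKi (hmax K hKs), heq K hKc hKi (hmax K hKs)]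
            rw [hne K hKJ] at hpos
            exact hopt K hKs hKi a ha hpos a' ha'
          · rw [Finset.card_le_one.1 (by omega) a ha a' ha']
    · refine ⟨c, hc, fun K hK hKi a ha hpos a' ha' => ?_⟩
      rcases Finset.mem_insert.1 hK with rfl | hKs
      · have : ¬ 2 ≤ (G.act K).card := fun h => hJ ⟨h, hKi⟩
        rw [Finset.card_le_one.1 (by omega) a ha a' ha']
      · exact hopt K hKs hKi a ha hpos a' ha'

/-- A counterfactual best response of player `i` to `σ_{-i}`; it exists under perfect recall,
see `exists_isCBR`. -/
noncomputable def cbr (G : EFGame A ι) (i : Fin 2) (σ : ι → A → ℝ) : ι → A → ℝ :=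
  Classical.epsilon (G.IsCBR i σ)

/-- Counterfactual best response value `CBV^{σ_{-i}}(I)`, `i` the owner of `I`. -/
noncomputable def cbv (G : EFGame A ι) (σ : ι → A → ℝ) (I : ι) : ℝ :=
  G.cfv (G.combine (G.owner I) (G.cbr (G.owner I) σ) σ) I

/-- Counterfactual best response value `CBV^{σ_{-i}}(I, a)` of an action. -/
noncomputable def cbvAct (G : EFGame A ι) (σ : ι → A → ℝ) (I : ι) (a : A) : ℝ :=
  G.cfvAct (G.combine (G.owner I) (G.cbr (G.owner I) σ) σ) I a

/-- `c_i` is a `T`-near counterfactual best response to `σ_{-i}` with tolerances `x I`. -/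
def IsNearCBR (G : EFGame A ι) (x : ι → ℝ) (T : ℕ) (i : Fin 2) (σ c : ι → A → ℝ) : Prop :=
  G.IsProfile c ∧ ∀ I, G.owner I = i →
    ∑ a ∈ G.act I,
      (max (G.cfvAct (G.combine i c σ) I a - G.cfv (G.combine i c σ) I) 0) ^ 2
        ≤ x I / (T : ℝ) ^ 2

/-- `NBV^{σ_{-i},T}(I, a)`: the least counterfactual value of `a` over all `T`-near
counterfactual best responses to `σ_{-i}`. -/
noncomputable def nbvAct (G : EFGame A ι) (x : ι → ℝ) (T : ℕ) (σ : ι → A → ℝ) (I : ι) (a : A) :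
    ℝ :=
  sInf {y | ∃ c, G.IsNearCBR x T (G.owner I) σ c ∧
    y = G.cfvAct (G.combine (G.owner I) c σ) I a}

/-- Regret matching: play in proportion to positive regret, uniformly if there is none. -/
noncomputable def regretMatching (G : EFGame A ι) (R : ι → A → ℝ) : ι → A → ℝ := fun I a =>
  if a ∈ G.act I then
    if 0 < ∑ b ∈ G.act I, max (R I b) 0 then
      max (R I a) 0 / ∑ b ∈ G.act I, max (R I b) 0
    else 1 / ((G.act I).card : ℝ)
  else 0

/-- The regrets `R^T(I, a)` after `T` iterations of CFR: iteration `T + 1` plays the profile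
given by regret matching and adds the instantaneous regret `v(I, a) - v(I)`. -/
noncomputable def cfrRegret (G : EFGame A ι) : ℕ → ι → A → ℝ
  | 0 => fun _ _ => 0
  | T + 1 => fun I a => cfrRegret G T I a +
      (G.cfvAct (G.regretMatching (cfrRegret G T)) I a -
        G.cfv (G.regretMatching (cfrRegret G T)) I)

/-- The profile `σ^t` played by CFR on iteration `t`, for `t = 1, 2, …`. -/
noncomputable def cfr (G : EFGame A ι) (t : ℕ) : ι → A → ℝ :=
  G.regretMatching (G.cfrRegret (t - 1))

/-- The average profile after `T` iterations of the sequence `σ^1, σ^2, …`. At an information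
set that its owner never reached, where the quotient is undefined, it is uniform. -/
noncomputable def average (G : EFGame A ι) (σ : ℕ → ι → A → ℝ) (T : ℕ) : ι → A → ℝ := fun I a =>
  if ∑ t ∈ Finset.Icc 1 T, G.reachInfo (σ t) I = 0 then
    G.uniformProfile I a
  else (∑ t ∈ Finset.Icc 1 T, G.reachInfo (σ t) I * σ t I a) /
    ∑ t ∈ Finset.Icc 1 T, G.reachInfo (σ t) I

end EFGame

/-!
The profiles form a compact set and the counterfactual values are polynomials in the profile, so
the strict inequality assumed at all Nash equilibria holds with a uniform margin at all approximate
Nash equilibria (`EFGame.exists_forall_le_neg_of_forall_isNash`). This is applied to pairs of a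
profile and a counterfactual best response to it, which form a closed set; that the hypothesis,
which concerns one chosen best response, extends to all of them is `EFGame.IsCBR.cfvAct_eq` and
`EFGame.IsCBR.cfv_eq`. The average CFR profiles are approximate Nash equilibria
(`EFGame.eventually_utility_add_le`), hence `CBV(I, a) ≤ CBV(I) - δ` at the average profile after
many iterations. Finally, CFR has vanishing average regret at `I` itself
(`EFGame.exists_sum_cfv_sub_le`), and against the average strategy of the opponent a fixed strategy
obtains the mean of its values against the iterates (`EFGame.natCast_mul_cfv_average`), so `CBV(I)`
exceeds the mean of the `v(I)` by `o(1)` only. Counterfactual best responses satisfy every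
tolerance, which gives the pruning condition.

Both the regret bounds and the optimality of counterfactual best responses come from one
performance difference formula (`EFGame.sum_reachOther_mul_nodeValue_sub`): replacing player `i`'s
strategy by `c` changes the value by a weighted sum of local gains `(c - σ)(J) · v^σ(J)` over the
information sets `J`, with weights that depend on `c` alone. The weights are attached to
information sets, not histories, by perfect recall. For the game as a whole this is the
definition of perfect recall; for the part of the game below `I` it is derived by inserting suitable profiles, and
requires that `I` has at least two actions (`EFGame.sum_ownFrom_eq`). If `I` has a single action,
the hypothesis of the theorem fails at every Nash equilibrium, and one exists
(`EFGame.exists_isNash`).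
-/

namespace EFGame

variable {A ι : Type*} [Fintype A] [DecidableEq A]

/-! ### Products along paths and values of histories -/

theorem pathProd_mul (w w' : List A → A → ℝ) (s : List A) : ∀ g : List A,
    pathProd (fun k b => w k b * w' k b) g s = pathProd w g s * pathProd w' g s := by
  induction s with
  | nil => intro g; simp [pathProd]
  | cons b s ih => intro g; simp only [pathProd, ih]; ring

/-- Two weights that agree at all moves of the path have the same product along it. -/
theorem pathProd_congr_of_split (w w' : List A → A → ℝ) (s : List A) : ∀ g : List A,
    (∀ s₁ b s₂, s = s₁ ++ b :: s₂ → w (g ++ s₁) b = w' (g ++ s₁) b) →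
      pathProd w g s = pathProd w' g s := by
  induction s with
  | nil => intro g _; rfl
  | cons b s ih =>
    intro g hw
    have h1 := hw [] b s rfl
    rw [List.append_nil] at h1
    rw [pathProd, pathProd, h1, ih]
    rintro s₁ b' s₂ rfl
    simpa using hw (b :: s₁) b' s₂ rfl

theorem exists_eq_zero_of_pathProd_eq_zero (w : List A → A → ℝ) (s : List A) : ∀ g : List A,
    pathProd w g s = 0 → ∃ s₁ b s₂, s = s₁ ++ b :: s₂ ∧ w (g ++ s₁) b = 0 := by
  induction s with
  | nil => intro g h; simp [pathProd] at h
  | cons b s ih =>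
    intro g h
    rcases mul_eq_zero.1 h with h | h
    · exact ⟨[], b, s, rfl, by simpa using h⟩
    · obtain ⟨s₁, b', s₂, rfl, h'⟩ := ih _ h
      exact ⟨b :: s₁, b', s₂, rfl, by simpa using h'⟩

theorem pathProd_mem_Icc (w : List A → A → ℝ) (hw : ∀ g b, w g b ∈ Set.Icc (0 : ℝ) 1)
    (s : List A) : ∀ g : List A, pathProd w g s ∈ Set.Icc (0 : ℝ) 1 := by
  induction s with
  | nil => intro g; simp [pathProd]
  | cons b s ih =>
    intro g
    have h1 := hw g b
    have h2 := ih (g ++ [b])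
    exact ⟨mul_nonneg h1.1 h2.1, mul_le_one₀ h1.2 h2.1 h2.2⟩

theorem mem_of_prefix (G : EFGame A ι) {g h : List A} (hgh : g <+: h) (hh : h ∈ G.H) :
    g ∈ G.H := by
  obtain ⟨s, rfl⟩ := hgh
  induction s using List.reverseRecOn with
  | nil => simpa using hh
  | append_singleton s b ih =>
    rw [← List.append_assoc] at hh
    exact ih (G.prefix_mem _ _ hh)

theorem IsProfile.mem_Icc {G : EFGame A ι} {σ : ι → A → ℝ} (hσ : G.IsProfile σ) (I : ι) (a : A) :
    σ I a ∈ Set.Icc (0 : ℝ) 1 := by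
  refine ⟨(hσ I).1 a, ?_⟩
  by_cases ha : a ∈ G.act I
  · rw [← (hσ I).2.2]
    exact Finset.single_le_sum (fun b _ => (hσ I).1 b) ha
  · rw [(hσ I).2.1 a ha]; exact zero_le_one

theorem IsProfile.sum_mul_eq {G : EFGame A ι} {σ : ι → A → ℝ} (hσ : G.IsProfile σ) (I : ι)
    (q : A → ℝ) : ∑ b, σ I b * q b = ∑ b ∈ G.act I, σ I b * q b := by
  refine (Finset.sum_subset (Finset.subset_univ _) fun b _ hb => ?_).symm
  rw [(hσ I).2.1 b hb, zero_mul]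

theorem IsProfile.sum_eq_one {G : EFGame A ι} {σ : ι → A → ℝ} (hσ : G.IsProfile σ) (I : ι) :
    ∑ b, σ I b = 1 := by
  simpa [(hσ I).2.2] using hσ.sum_mul_eq I fun _ => 1

theorem IsProfile.combine {G : EFGame A ι} {τ σ : ι → A → ℝ} (hτ : G.IsProfile τ)
    (hσ : G.IsProfile σ) (i : Fin 2) : G.IsProfile (G.combine i τ σ) := by
  intro I
  unfold EFGame.combine
  split_ifs
  · exact hτ I
  · exact hσ I

theorem combine_combine (G : EFGame A ι) (i : Fin 2) (c c' σ : ι → A → ℝ) :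
    G.combine i c (G.combine i c' σ) = G.combine i c σ := by
  funext I
  unfold combine
  split_ifs <;> rfl

theorem ownProb_mem_Icc {G : EFGame A ι} {σ : ι → A → ℝ} (hσ : G.IsProfile σ) (i : Fin 2)
    (g : List A) (b : A) : G.ownProb σ i g b ∈ Set.Icc (0 : ℝ) 1 := by
  unfold ownProb
  split
  · split_ifs
    · exact hσ.mem_Icc _ _
    · simp
  · simp

theorem moveProb_combine (G : EFGame A ι) (i : Fin 2) (c σ : ι → A → ℝ) (g : List A) (b : A) :
    G.moveProb (G.combine i c σ) g b = G.ownProb c i g b * G.otherProb σ i g b := by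
  unfold moveProb ownProb otherProb combine
  split
  · split_ifs <;> simp
  · simp

theorem otherProb_combine (G : EFGame A ι) (i : Fin 2) (c σ : ι → A → ℝ) :
    G.otherProb (G.combine i c σ) i = G.otherProb σ i := by
  funext g b
  unfold otherProb combine
  split
  · split_ifs <;> rfl
  · rfl

theorem reachOther_combine (G : EFGame A ι) (i : Fin 2) (c σ : ι → A → ℝ) (h : List A) :
    G.reachOther (G.combine i c σ) i h = G.reachOther σ i h := by
  rw [reachOther, otherProb_combine, reachOther]

/-- Player `i`'s contribution to the probability of reaching `h` from `g`; like `reachFrom`, it is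
`0` if `g` is not an initial segment of `h`. -/
def ownFrom (G : EFGame A ι) (σ : ι → A → ℝ) (i : Fin 2) (g h : List A) : ℝ :=
  if g <+: h then pathProd (G.ownProb σ i) g (h.drop g.length) else 0

theorem ownFrom_mem_Icc {G : EFGame A ι} {σ : ι → A → ℝ} (hσ : G.IsProfile σ) (i : Fin 2)
    (g h : List A) : G.ownFrom σ i g h ∈ Set.Icc (0 : ℝ) 1 := by
  unfold ownFrom
  split_ifs
  · exact pathProd_mem_Icc _ (ownProb_mem_Icc hσ i) _ _
  · simp

theorem ownFrom_nil (G : EFGame A ι) (σ : ι → A → ℝ) (i : Fin 2) (h : List A) :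
    G.ownFrom σ i [] h = G.reachOwn σ i h := by
  simp [ownFrom, reachOwn]

theorem reachFrom_nil (G : EFGame A ι) (σ : ι → A → ℝ) (h : List A) :
    G.reachFrom σ [] h = G.reach σ h := by
  simp [reachFrom, reach]

theorem reachOther_mul_reachFrom (G : EFGame A ι) (i : Fin 2) (c σ : ι → A → ℝ) (g h : List A) :
    G.reachOther σ i g * G.reachFrom (G.combine i c σ) g h
      = G.ownFrom c i g h * G.reachOther σ i h := by
  unfold reachFrom ownFrom
  split_ifs with hgh
  · obtain ⟨s, rfl⟩ := hgh
    have hm : G.moveProb (G.combine i c σ)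
        = fun k b => G.ownProb c i k b * G.otherProb σ i k b := by
      funext k b; exact G.moveProb_combine i c σ k b
    rw [hm, pathProd_mul, List.drop_left, reachOther, reachOther, pathProd_append,
      List.nil_append]
    ring
  · simp

/-- One step of the recursion for `π^σ(g, h)`. The sum runs over all of `A`, since at most one
summand is nonzero. -/
theorem reachFrom_eq_sum (G : EFGame A ι) (σ : ι → A → ℝ) {g h : List A} (hgh : g ≠ h) :
    G.reachFrom σ g h = ∑ b, G.moveProb σ g b * G.reachFrom σ (g ++ [b]) h := by
  by_cases hp : g <+: h
  · obtain ⟨s, rfl⟩ := hp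
    cases s with
    | nil => simp at hgh
    | cons b s =>
      rw [Finset.sum_eq_single b]
      · have h1 : g ++ [b] <+: g ++ b :: s := ⟨s, by simp⟩
        have h2 : (g ++ b :: s).drop (g ++ [b]).length = s := by
          rw [show g ++ b :: s = (g ++ [b]) ++ s by simp, List.drop_left]
        rw [reachFrom, if_pos ⟨_, rfl⟩, List.drop_left, reachFrom, if_pos h1, h2, pathProd]
      · intro b' _ hb'
        rw [reachFrom, if_neg, mul_zero]
        rintro ⟨s', hs'⟩
        simp at hs'
        exact hb' hs'.1
      · simp
  · rw [reachFrom, if_neg hp, Finset.sum_eq_zero]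
    intro b _
    rw [reachFrom, if_neg, mul_zero]
    exact fun h' => hp ((List.prefix_append _ _).trans h')

theorem reachFrom_append_self (G : EFGame A ι) (σ : ι → A → ℝ) (g : List A) (b : A) :
    G.reachFrom σ (g ++ [b]) g = 0 := by
  rw [reachFrom, if_neg]
  intro h
  simpa using h.length_le

/-- The expected payoff of player `i` when play starts at the history `g`. -/
def nodeValue (G : EFGame A ι) (i : Fin 2) (σ : ι → A → ℝ) (g : List A) : ℝ :=
  ∑ z ∈ G.terminals, G.reachFrom σ g z * G.payoff i z

theorem utility_eq_nodeValue (G : EFGame A ι) (i : Fin 2) (σ : ι → A → ℝ) :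
    G.utility i σ = G.nodeValue i σ [] := by
  simp only [utility, nodeValue, reachFrom_nil]

theorem nodeValue_eq_sum (G : EFGame A ι) (i : Fin 2) (σ : ι → A → ℝ) {g : List A}
    (hg : g ∉ G.terminals) :
    G.nodeValue i σ g = ∑ b, G.moveProb σ g b * G.nodeValue i σ (g ++ [b]) := by
  simp only [nodeValue, Finset.mul_sum]
  rw [Finset.sum_comm]
  refine Finset.sum_congr rfl fun z hz => ?_
  rw [G.reachFrom_eq_sum σ (fun h : g = z => hg (h ▸ hz)), Finset.sum_mul]
  exact Finset.sum_congr rfl fun b _ => by ring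

theorem nodeValue_eq_zero (G : EFGame A ι) (i : Fin 2) (σ : ι → A → ℝ) {g : List A}
    (hg : ∀ z ∈ G.H, ¬ g <+: z) : G.nodeValue i σ g = 0 := by
  refine Finset.sum_eq_zero fun z hz => ?_
  rw [reachFrom, if_neg (hg z (Finset.mem_filter.1 hz).1), zero_mul]

theorem nodeValue_of_mem_terminals (G : EFGame A ι) (i : Fin 2) (σ : ι → A → ℝ) {g : List A}
    (hg : g ∈ G.terminals) : G.nodeValue i σ g = G.payoff i g := by
  rw [nodeValue, Finset.sum_eq_single g]
  · simp [reachFrom, pathProd]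
  · intro z hz hzg
    rw [reachFrom, if_neg, zero_mul]
    rintro ⟨s, rfl⟩
    cases s with
    | nil => simp at hzg
    | cons b s =>
      refine (Finset.mem_filter.1 hg).2 b (G.mem_of_prefix ?_ (Finset.mem_filter.1 hz).1)
      exact ⟨s, by simp⟩
  · exact fun h => absurd hg h

/-! ### The performance difference formula -/

/-- Induction on a bound `n` for the number of moves that can follow `g`; a history `g` outside the
game has value `0` on both sides. -/
theorem nodeValue_sub_nodeValue_aux (G : EFGame A ι) (i : Fin 2) (σ' σ : ι → A → ℝ) (n : ℕ) :
    ∀ g : List A, (∀ h ∈ G.H, h.length < g.length + n) →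
    G.nodeValue i σ' g - G.nodeValue i σ g = ∑ h ∈ G.H, G.reachFrom σ' g h *
      ∑ b, (G.moveProb σ' h b - G.moveProb σ h b) * G.nodeValue i σ (h ++ [b]) := by
  have hout : ∀ g : List A, (∀ h ∈ G.H, ¬ g <+: h) →
      G.nodeValue i σ' g - G.nodeValue i σ g = ∑ h ∈ G.H, G.reachFrom σ' g h *
        ∑ b, (G.moveProb σ' h b - G.moveProb σ h b) * G.nodeValue i σ (h ++ [b]) := by
    intro g hno
    rw [G.nodeValue_eq_zero i σ' hno, G.nodeValue_eq_zero i σ hno, sub_zero,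
      Finset.sum_eq_zero]
    intro h hh
    rw [reachFrom, if_neg (hno h hh), zero_mul]
  induction n with
  | zero =>
    intro g hg
    exact hout g fun h hh hp => absurd (hg h hh) (by simpa using hp.length_le)
  | succ n ih =>
    intro g hg
    by_cases hgH : g ∈ G.H
    swap
    · exact hout g fun h hh hp => hgH (G.mem_of_prefix hp hh)
    set D : List A → ℝ := fun h =>
      ∑ b, (G.moveProb σ' h b - G.moveProb σ h b) * G.nodeValue i σ (h ++ [b]) with hD
    have hrec : ∑ h ∈ G.H, G.reachFrom σ' g h * D h
        = D g + ∑ b, G.moveProb σ' g b *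
          (G.nodeValue i σ' (g ++ [b]) - G.nodeValue i σ (g ++ [b])) := by
      have h1 : ∀ b, G.nodeValue i σ' (g ++ [b]) - G.nodeValue i σ (g ++ [b])
          = ∑ h ∈ G.H, G.reachFrom σ' (g ++ [b]) h * D h := by
        intro b
        refine ih (g ++ [b]) fun h hh => ?_
        have := hg h hh
        simp only [List.length_append, List.length_singleton]
        omega
      simp only [h1, Finset.mul_sum]
      rw [Finset.sum_comm, ← Finset.add_sum_erase _ _ hgH, ← Finset.add_sum_erase _ _ hgH,
        Finset.sum_eq_zero (s := Finset.univ) (f := fun b =>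
          G.moveProb σ' g b * (G.reachFrom σ' (g ++ [b]) g * D g))
          (fun b _ => by rw [reachFrom_append_self]; ring), zero_add]
      congr 1
      · simp [reachFrom, pathProd]
      · refine Finset.sum_congr rfl fun h hh => ?_
        rw [G.reachFrom_eq_sum σ' (Finset.ne_of_mem_erase hh).symm, Finset.sum_mul]
        exact Finset.sum_congr rfl fun b _ => by ring
    rw [hrec]
    by_cases hgt : g ∈ G.terminals
    · have h0 : ∀ (ρ : ι → A → ℝ) b, G.nodeValue i ρ (g ++ [b]) = 0 := by
        intro ρ b
        refine G.nodeValue_eq_zero i ρ fun z hz hp => ?_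
        exact (Finset.mem_filter.1 hgt).2 b (G.mem_of_prefix hp hz)
      rw [G.nodeValue_of_mem_terminals i σ' hgt, G.nodeValue_of_mem_terminals i σ hgt]
      simp [hD, h0]
    · rw [G.nodeValue_eq_sum i σ' hgt, G.nodeValue_eq_sum i σ hgt, hD,
        ← Finset.sum_sub_distrib, ← Finset.sum_add_distrib]
      exact Finset.sum_congr rfl fun b _ => by ring

/-- Performance difference formula: changing `σ` into `σ'` changes the value of `g` by the sum,
over all later histories `h`, of the probability under `σ'` of reaching `h` times the gain of
deviating to `σ'` for the single move at `h`. -/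
theorem nodeValue_sub_nodeValue (G : EFGame A ι) (i : Fin 2) (σ' σ : ι → A → ℝ) (g : List A) :
    G.nodeValue i σ' g - G.nodeValue i σ g = ∑ h ∈ G.H, G.reachFrom σ' g h *
      ∑ b, (G.moveProb σ' h b - G.moveProb σ h b) * G.nodeValue i σ (h ++ [b]) := by
  refine G.nodeValue_sub_nodeValue_aux i σ' σ (G.H.sup List.length + 1) g fun h hh => ?_
  have := Finset.le_sup (f := List.length) hh
  omega

theorem finite_infosets (G : EFGame A ι) : Finite ι := by
  refine Finite.of_injective (β := G.H) (fun I => ⟨(G.infoset_nonempty I).choose,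
    G.infoset_mem _ I (G.infoset_nonempty I).choose_spec⟩) fun I J hIJ => ?_
  have h1 := (G.infoset_nonempty I).choose_spec
  rw [Subtype.mk.inj hIJ, (G.infoset_nonempty J).choose_spec] at h1
  exact (Option.some.inj h1).symm

variable [DecidableEq ι]

theorem mem_nodes (G : EFGame A ι) {I : ι} {h : List A} :
    h ∈ G.nodes I ↔ G.infoset h = some I := by
  simp only [nodes, Finset.mem_filter, and_iff_right_iff_imp]
  exact G.infoset_mem h I

theorem cfvAct_eq (G : EFGame A ι) (σ : ι → A → ℝ) (I : ι) (a : A) :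
    G.cfvAct σ I a = ∑ h ∈ G.nodes I, G.reachOther σ (G.owner I) h *
      G.nodeValue (G.owner I) σ (h ++ [a]) := rfl

theorem cfv_eq_sum (G : EFGame A ι) (σ : ι → A → ℝ) (I : ι) :
    G.cfv σ I = ∑ b, σ I b * G.cfvAct σ I b := by
  have h1 : G.cfv σ I = ∑ h ∈ G.nodes I, G.reachOther σ (G.owner I) h *
      G.nodeValue (G.owner I) σ h := rfl
  simp only [h1, cfvAct_eq, Finset.mul_sum]
  rw [Finset.sum_comm]
  refine Finset.sum_congr rfl fun h hh => ?_
  rw [mem_nodes] at hh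
  have hnt : h ∉ G.terminals := by
    intro ht
    obtain ⟨b, hb⟩ := G.act_nonempty I
    exact (Finset.mem_filter.1 ht).2 b ((G.infoset_act h I hh b).1 hb)
  rw [G.nodeValue_eq_sum _ σ hnt, Finset.mul_sum]
  refine Finset.sum_congr rfl fun b _ => ?_
  rw [moveProb, hh]
  ring

/-- Performance difference formula summed over information sets, for play starting from the
histories `g k` with `k ∈ S`. The hypothesis says that the weight with which player `i`'s own
moves lead to a history of `J` is the same for all histories of `J`. -/
theorem sum_reachOther_mul_nodeValue_sub [Fintype ι] {κ : Type*} (G : EFGame A ι) (i : Fin 2)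
    (c σ : ι → A → ℝ) (S : Finset κ) (g : κ → List A) (ω : ι → ℝ)
    (hω : ∀ J, G.owner J = i → ∀ h, G.infoset h = some J →
      ∑ k ∈ S, G.ownFrom c i (g k) h = ω J) :
    ∑ k ∈ S, G.reachOther σ i (g k) *
        (G.nodeValue i (G.combine i c σ) (g k) - G.nodeValue i σ (g k))
      = ∑ J with G.owner J = i, ω J * ∑ b, (c J b - σ J b) * G.cfvAct σ J b := by
  set D : List A → ℝ := fun h => ∑ b, (G.moveProb (G.combine i c σ) h b - G.moveProb σ h b) *
    G.nodeValue i σ (h ++ [b]) with hD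
  have hDsome : ∀ J h, G.infoset h = some J → G.owner J = i →
      D h = ∑ b, (c J b - σ J b) * G.nodeValue i σ (h ++ [b]) := by
    intro J h hh hJ
    simp [hD, moveProb, hh, combine, hJ]
  have hDnone : ∀ h, (∀ J, G.owner J = i → G.infoset h ≠ some J) → D h = 0 := by
    intro h hh
    refine Finset.sum_eq_zero fun b _ => ?_
    unfold moveProb combine
    split
    · rename_i J hJ
      rw [if_neg (fun ho => hh J ho hJ), sub_self, zero_mul]
    · simp
  calc ∑ k ∈ S, G.reachOther σ i (g k) *
        (G.nodeValue i (G.combine i c σ) (g k) - G.nodeValue i σ (g k))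
      = ∑ h ∈ G.H, (∑ k ∈ S, G.ownFrom c i (g k) h) * (G.reachOther σ i h * D h) := by
        simp only [Finset.sum_mul]
        rw [Finset.sum_comm]
        refine Finset.sum_congr rfl fun k _ => ?_
        rw [nodeValue_sub_nodeValue, Finset.mul_sum]
        refine Finset.sum_congr rfl fun h _ => ?_
        rw [← mul_assoc, ← mul_assoc, reachOther_mul_reachFrom]
    _ = ∑ J with G.owner J = i, ∑ h ∈ G.nodes J, ω J * (G.reachOther σ i h * D h) := by
        simp only [nodes, Finset.sum_filter (s := G.H)]
        rw [Finset.sum_comm]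
        refine Finset.sum_congr rfl fun h _ => ?_
        by_cases hex : ∃ J, G.owner J = i ∧ G.infoset h = some J
        · obtain ⟨J, hJ, hh⟩ := hex
          rw [Finset.sum_eq_single J, if_pos hh, hω J hJ h hh]
          · intro K _ hK
            rw [if_neg]
            exact fun hh' => hK (Option.some.inj (hh'.symm.trans hh))
          · exact fun hJ' => absurd (Finset.mem_filter.2 ⟨Finset.mem_univ J, hJ⟩) hJ'
        · push Not at hex
          rw [hDnone h hex, mul_zero, mul_zero]
          exact (Finset.sum_eq_zero fun J _ => by simp).symm
    _ = _ := by
        refine Finset.sum_congr rfl fun J hJ => ?_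
        have hJ' := (Finset.mem_filter.1 hJ).2
        rw [← Finset.mul_sum]
        congr 1
        simp only [cfvAct_eq, Finset.mul_sum, hJ']
        rw [Finset.sum_comm]
        refine Finset.sum_congr rfl fun h hh => ?_
        rw [hDsome J h (G.mem_nodes.1 hh) hJ', Finset.mul_sum]
        exact Finset.sum_congr rfl fun b _ => by ring

end EFGame

namespace EFGame

variable {A ι : Type*} [Fintype A] [DecidableEq A]

/-! ### Reach weights below an information set -/

theorem reachOwn_mem_Icc {G : EFGame A ι} {σ : ι → A → ℝ} (hσ : G.IsProfile σ) (i : Fin 2)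
    (h : List A) : G.reachOwn σ i h ∈ Set.Icc (0 : ℝ) 1 :=
  pathProd_mem_Icc _ (ownProb_mem_Icc hσ i) _ _

theorem reachOwn_append_le {G : EFGame A ι} {σ : ι → A → ℝ} (hσ : G.IsProfile σ) (i : Fin 2)
    (g s : List A) : G.reachOwn σ i (g ++ s) ≤ G.reachOwn σ i g := by
  rw [reachOwn, pathProd_append]
  exact mul_le_of_le_one_right (pathProd_mem_Icc _ (ownProb_mem_Icc hσ i) _ _).1
    (pathProd_mem_Icc _ (ownProb_mem_Icc hσ i) _ _).2

/-- The profile that is uniform except that it never plays `a` at `I`. -/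
noncomputable def avoidingProfile (G : EFGame A ι) [DecidableEq ι] (I : ι) (a : A) :
    ι → A → ℝ :=
  Function.update G.uniformProfile I fun b =>
    if b ∈ (G.act I).erase a then 1 / (((G.act I).erase a).card : ℝ) else 0

variable [DecidableEq ι]

theorem isProfile_avoidingProfile (G : EFGame A ι) (I : ι) (a : A) (hcard : 2 ≤ (G.act I).card)
    (ha : a ∈ G.act I) : G.IsProfile (G.avoidingProfile I a) := by
  intro K
  by_cases hK : K = I
  · subst hK
    have hc : 0 < (((G.act K).erase a).card : ℝ) := by
      rw [Finset.card_erase_of_mem ha]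
      exact_mod_cast (by omega : 0 < (G.act K).card - 1)
    simp only [avoidingProfile, Function.update_self]
    refine ⟨fun b => by split_ifs <;> positivity, fun b hb => ?_, ?_⟩
    · rw [if_neg (fun h => hb (Finset.mem_of_mem_erase h))]
    · rw [← Finset.sum_filter, Finset.filter_mem_eq_inter,
        Finset.inter_eq_right.2 (Finset.erase_subset _ _)]
      simp only [Finset.sum_const, nsmul_eq_mul]
      field_simp
  · rw [avoidingProfile, Function.update_of_ne hK]
    exact G.isProfile_uniformProfile K

theorem avoidingProfile_eq_zero (G : EFGame A ι) {I K : ι} {a b : A} (hb : b ∈ G.act K)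
    (h0 : G.avoidingProfile I a K b = 0) : K = I ∧ b = a := by
  by_cases hK : K = I
  · subst hK
    refine ⟨rfl, ?_⟩
    by_contra hba
    have hm : b ∈ (G.act K).erase a := Finset.mem_erase.2 ⟨hba, hb⟩
    simp only [avoidingProfile, Function.update_self, if_pos hm] at h0
    have := Finset.card_pos.2 ⟨b, hm⟩
    exact (ne_of_gt (by positivity)) h0
  · rw [avoidingProfile, Function.update_of_ne hK, uniformProfile, if_pos hb] at h0
    have := (G.act_nonempty K).card_pos
    exact absurd h0 (ne_of_gt (by positivity))

/-- Perfect recall: at an information set of player `i`, either all histories or none come after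
playing `a` at `I`. The profile that never plays `a` at `I` and is otherwise positive tells the two
cases apart. -/
theorem exists_prefix_of_prefix (G : EFGame A ι) (hr : G.PerfectRecall) {I J : ι} {a : A}
    (hcard : 2 ≤ (G.act I).card) (ha : a ∈ G.act I) (hJ : G.owner J = G.owner I)
    {g h h' : List A} (hg : G.infoset g = some I) (hh : G.infoset h = some J)
    (hh' : G.infoset h' = some J) (hgh : g ++ [a] <+: h) :
    ∃ g', G.infoset g' = some I ∧ g' ++ [a] <+: h' := by
  have hp := G.isProfile_avoidingProfile I a hcard ha
  have h0 : G.reachOwn (G.avoidingProfile I a) (G.owner I) h = 0 := by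
    obtain ⟨s, rfl⟩ := hgh
    rw [reachOwn, pathProd_append, pathProd_append]
    simp [pathProd, ownProb, hg, avoidingProfile]
  have h1 := hr _ hp J h h' hh hh'
  rw [hJ, h0] at h1
  obtain ⟨s₁, b, s₂, rfl, hz⟩ := exists_eq_zero_of_pathProd_eq_zero _ _ _ h1.symm
  rw [List.nil_append] at hz
  have hpre : s₁ ++ [b] <+: s₁ ++ b :: s₂ := ⟨s₂, by simp⟩
  unfold ownProb at hz
  split at hz
  · rename_i K hK
    split_ifs at hz
    · have hb := (G.infoset_act s₁ K hK b).2
        (G.mem_of_prefix hpre (G.infoset_mem _ _ hh'))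
      obtain ⟨rfl, rfl⟩ := G.avoidingProfile_eq_zero hb hz
      exact ⟨s₁, hK, hpre⟩
    · exact absurd hz one_ne_zero
  · exact absurd hz one_ne_zero

/-- There is no absent-mindedness at an information set with at least two actions. -/
theorem eq_of_prefix_of_prefix (G : EFGame A ι) (hr : G.PerfectRecall) {I : ι} {a : A}
    (hcard : 2 ≤ (G.act I).card) {g g' h : List A} (hg : G.infoset g = some I)
    (hg' : G.infoset g' = some I) (hgh : g ++ [a] <+: h) (hgh' : g' ++ [a] <+: h) : g = g' := by
  wlog hle : g.length ≤ g'.length generalizing g g'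
  · exact (this hg' hg hgh' hgh (by omega)).symm
  by_contra hne
  have hlt : g.length < g'.length := by
    refine lt_of_le_of_ne hle fun he => hne ?_
    have := List.prefix_of_prefix_length_le hgh hgh' (by simp [he])
    exact List.append_inj_left (this.eq_of_length (by simp [he])) he
  have hpre : g ++ [a] <+: g' :=
    List.prefix_of_prefix_length_le hgh ((List.prefix_append _ _).trans hgh')
      (by simp only [List.length_append, List.length_singleton]; omega)
  obtain ⟨s, rfl⟩ := hpre
  have h1 := G.reachOwn_uniform_lt I g hg hcard a s
  rw [hr _ G.isProfile_uniformProfile I _ _ hg hg'] at h1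
  exact lt_irrefl _ h1

/-- The profile that plays uniformly until `I` has been passed, and `c` afterwards. Progress is
measured by the reach probability of the uniform profile, which drops strictly at `I`. -/
noncomputable def laterProfile (G : EFGame A ι) (I : ι) (c : ι → A → ℝ) : ι → A → ℝ := fun K =>
  if G.reachInfo G.uniformProfile K < G.reachInfo G.uniformProfile I then c K
  else G.uniformProfile K

theorem isProfile_laterProfile (G : EFGame A ι) (I : ι) {c : ι → A → ℝ} (hc : G.IsProfile c) :
    G.IsProfile (G.laterProfile I c) := by
  intro K
  unfold laterProfile
  split_ifs
  · exact hc K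
  · exact G.isProfile_uniformProfile K

theorem reachOwn_laterProfile (G : EFGame A ι) (hr : G.PerfectRecall) {I : ι} {a : A}
    (hcard : 2 ≤ (G.act I).card) (ha : a ∈ G.act I) (c : ι → A → ℝ) {g h : List A}
    (hg : G.infoset g = some I) (hgh : g ++ [a] <+: h) :
    G.reachOwn (G.laterProfile I c) (G.owner I) h
      = G.reachInfo G.uniformProfile I / (G.act I).card * G.ownFrom c (G.owner I) (g ++ [a]) h := by
  have hI := G.reachInfo_eq hr _ G.isProfile_uniformProfile I g hg
  rw [ownFrom, if_pos hgh]
  obtain ⟨s, rfl⟩ := hgh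
  rw [List.drop_left, reachOwn, pathProd_append, pathProd_append, List.nil_append,
    List.nil_append]
  have h1 : pathProd (G.ownProb (G.laterProfile I c) (G.owner I)) [] g
      = G.reachInfo G.uniformProfile I := by
    rw [hI, reachOwn]
    refine pathProd_congr_of_split _ _ _ _ fun s₁ b s₂ hs => ?_
    rw [List.nil_append]
    unfold ownProb
    split
    · rename_i K hK
      split_ifs with ho
      · rw [laterProfile, if_neg]
        rw [not_lt, hI, G.reachInfo_eq hr _ G.isProfile_uniformProfile K _ hK, ho, hs]
        exact reachOwn_append_le G.isProfile_uniformProfile _ _ _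
      · rfl
    · rfl
  have h2 : pathProd (G.ownProb (G.laterProfile I c) (G.owner I)) g [a]
      = 1 / (G.act I).card := by
    simp [pathProd, ownProb, hg, laterProfile, uniformProfile, ha]
  have h3 : pathProd (G.ownProb (G.laterProfile I c) (G.owner I)) (g ++ [a]) s
      = pathProd (G.ownProb c (G.owner I)) (g ++ [a]) s := by
    refine pathProd_congr _ _ _ _ fun s₁ b => ?_
    unfold ownProb
    split
    · rename_i K hK
      split_ifs with ho
      · rw [laterProfile, if_pos]
        rw [hI, G.reachInfo_eq hr _ G.isProfile_uniformProfile K _ hK, ho]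
        exact G.reachOwn_uniform_lt I g hg hcard a s₁
      · rfl
    · rfl
  rw [h1, h2, h3]
  ring

/-- The weight with which player `i`'s own moves according to `c` lead from playing `a` at `I` to a
history of `J` is the same for all histories of `J`. Where it is nonzero, it is up to a constant
the reach probability under `laterProfile`; using that profile in place of `c` avoids a division by
the probability with which `c` reaches `I`, which may vanish. -/
theorem sum_ownFrom_eq (G : EFGame A ι) (hr : G.PerfectRecall) {I J : ι} {a : A}
    (hcard : 2 ≤ (G.act I).card) (ha : a ∈ G.act I) {c : ι → A → ℝ} (hc : G.IsProfile c)
    (hJ : G.owner J = G.owner I) {h h' : List A} (hh : G.infoset h = some J)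
    (hh' : G.infoset h' = some J) :
    ∑ g ∈ G.nodes I, G.ownFrom c (G.owner I) (g ++ [a]) h
      = ∑ g ∈ G.nodes I, G.ownFrom c (G.owner I) (g ++ [a]) h' := by
  have hsingle : ∀ {k g : List A}, G.infoset g = some I → g ++ [a] <+: k →
      ∑ g ∈ G.nodes I, G.ownFrom c (G.owner I) (g ++ [a]) k
        = G.ownFrom c (G.owner I) (g ++ [a]) k := by
    intro k g hg hgk
    refine Finset.sum_eq_single g (fun g' hg' hne => ?_)
      (fun hn => absurd (G.mem_nodes.2 hg) hn)
    rw [ownFrom, if_neg]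
    exact fun hp => hne (G.eq_of_prefix_of_prefix hr hcard (G.mem_nodes.1 hg') hg hp hgk)
  by_cases hex : ∃ g, G.infoset g = some I ∧ g ++ [a] <+: h
  · obtain ⟨g, hg, hgh⟩ := hex
    obtain ⟨g', hg', hgh'⟩ := G.exists_prefix_of_prefix hr hcard ha hJ hg hh hh' hgh
    rw [hsingle hg hgh, hsingle hg' hgh']
    have hκ : G.reachInfo G.uniformProfile I / (G.act I).card ≠ 0 := by
      rw [G.reachInfo_eq hr _ G.isProfile_uniformProfile I g hg]
      have h1 := G.reachOwn_uniform_pos (G.owner I) g (G.infoset_mem _ _ hg)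
      have h2 : (0 : ℝ) < (G.act I).card := by exact_mod_cast (G.act_nonempty I).card_pos
      positivity
    refine mul_left_cancel₀ hκ ?_
    rw [← G.reachOwn_laterProfile hr hcard ha c hg hgh,
      ← G.reachOwn_laterProfile hr hcard ha c hg' hgh', ← hJ]
    exact hr _ (G.isProfile_laterProfile I hc) J h h' hh hh'
  · have hex' : ¬ ∃ g, G.infoset g = some I ∧ g ++ [a] <+: h' := by
      rintro ⟨g, hg, hgh⟩
      exact hex (G.exists_prefix_of_prefix hr hcard ha hJ hg hh' hh hgh)
    have hzero : ∀ k, (¬ ∃ g, G.infoset g = some I ∧ g ++ [a] <+: k) →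
        ∑ g ∈ G.nodes I, G.ownFrom c (G.owner I) (g ++ [a]) k = 0 := by
      intro k hk
      refine Finset.sum_eq_zero fun g hg => ?_
      rw [ownFrom, if_neg fun hp => hk ⟨g, G.mem_nodes.1 hg, hp⟩]
    rw [hzero h hex, hzero h' hex']

/-- Performance difference formula for the counterfactual value of an action. The weights `ω` are
the probabilities with which player `i`'s own moves according to `c` lead from `I` and `a` to the
later information sets. -/
theorem exists_cfvAct_combine_sub_eq [Fintype ι] (G : EFGame A ι) (hr : G.PerfectRecall) {I : ι}
    {a : A} (hcard : 2 ≤ (G.act I).card) (ha : a ∈ G.act I) {c : ι → A → ℝ}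
    (hc : G.IsProfile c) :
    ∃ ω : ι → ℝ, (∀ J, ω J ∈ Set.Icc (0 : ℝ) (G.nodes I).card) ∧ ∀ σ : ι → A → ℝ,
      G.cfvAct (G.combine (G.owner I) c σ) I a - G.cfvAct σ I a
        = ∑ J with G.owner J = G.owner I, ω J * ∑ b, (c J b - σ J b) * G.cfvAct σ J b := by
  refine ⟨fun J => ∑ g ∈ G.nodes I,
    G.ownFrom c (G.owner I) (g ++ [a]) (G.infoset_nonempty J).choose, fun J => ⟨?_, ?_⟩,
    fun σ => ?_⟩
  · exact Finset.sum_nonneg fun g _ => (ownFrom_mem_Icc hc _ _ _).1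
  · refine (Finset.sum_le_card_nsmul _ _ 1 fun g _ => (ownFrom_mem_Icc hc _ _ _).2).trans ?_
    simp
  · rw [← G.sum_reachOther_mul_nodeValue_sub (G.owner I) c σ (G.nodes I) (fun g => g ++ [a]) _
      (fun J hJ h hh => G.sum_ownFrom_eq hr hcard ha hc hJ hh (G.infoset_nonempty J).choose_spec),
      cfvAct_eq, cfvAct_eq, ← Finset.sum_sub_distrib]
    refine Finset.sum_congr rfl fun g hg => ?_
    have h1 : G.reachOther σ (G.owner I) (g ++ [a]) = G.reachOther σ (G.owner I) g := by
      rw [reachOther, pathProd_append]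
      simp [pathProd, otherProb, G.mem_nodes.1 hg, reachOther]
    rw [reachOther_combine, h1]
    ring

/-- Performance difference formula for the whole game. -/
theorem utility_combine_sub_eq [Fintype ι] (G : EFGame A ι) (hr : G.PerfectRecall) (i : Fin 2)
    {c : ι → A → ℝ} (hc : G.IsProfile c) (σ : ι → A → ℝ) :
    G.utility i (G.combine i c σ) - G.utility i σ
      = ∑ J with G.owner J = i, G.reachInfo c J * ∑ b, (c J b - σ J b) * G.cfvAct σ J b := by
  rw [← G.sum_reachOther_mul_nodeValue_sub i c σ {()} (fun _ => []) _ ?_]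
  · simp [utility_eq_nodeValue, reachOther, pathProd]
  · intro J hJ h hh
    rw [Finset.sum_singleton, ownFrom_nil, ← hJ, G.reachInfo_eq hr c hc J h hh]

/-! ### Counterfactual best responses -/

theorem IsCBR.cfvAct_le_cfv {G : EFGame A ι} {i : Fin 2} {σ c : ι → A → ℝ} (h : G.IsCBR i σ c)
    {I : ι} (hI : G.owner I = i) {a : A} (ha : a ∈ G.act I) :
    G.cfvAct (G.combine i c σ) I a ≤ G.cfv (G.combine i c σ) I := by
  have hc : G.combine i c σ I = c I := if_pos hI
  rw [cfv_eq_sum, hc, h.1.sum_mul_eq]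
  calc G.cfvAct (G.combine i c σ) I a
      = ∑ b ∈ G.act I, c I b * G.cfvAct (G.combine i c σ) I a := by
        rw [← Finset.sum_mul, (h.1 I).2.2, one_mul]
    _ ≤ _ := by
        refine Finset.sum_le_sum fun b hb => ?_
        rcases ((h.1 I).1 b).eq_or_lt with h0 | h0
        · rw [← h0, zero_mul, zero_mul]
        · exact mul_le_mul_of_nonneg_left (h.2 I hI b hb h0 a ha) h0.le

/-- A counterfactual best response maximises the counterfactual values of all actions. -/
theorem IsCBR.cfvAct_le (G : EFGame A ι) (hr : G.PerfectRecall) {I : ι} {a : A}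
    (hcard : 2 ≤ (G.act I).card) (ha : a ∈ G.act I) {σ c c' : ι → A → ℝ}
    (h : G.IsCBR (G.owner I) σ c) (hc' : G.IsProfile c') :
    G.cfvAct (G.combine (G.owner I) c' σ) I a ≤ G.cfvAct (G.combine (G.owner I) c σ) I a := by
  have := G.finite_infosets
  have := Fintype.ofFinite ι
  obtain ⟨ω, hω, hpd⟩ := G.exists_cfvAct_combine_sub_eq hr hcard ha hc'
  have h1 := hpd (G.combine (G.owner I) c σ)
  rw [combine_combine] at h1
  rw [← sub_nonpos, h1]
  refine Finset.sum_nonpos fun J hJ => mul_nonpos_of_nonneg_of_nonpos (hω J).1 ?_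
  have hJ' := (Finset.mem_filter.1 hJ).2
  simp only [sub_mul, Finset.sum_sub_distrib]
  rw [← cfv_eq_sum, sub_nonpos, hc'.sum_mul_eq]
  calc _ ≤ ∑ b ∈ G.act J, c' J b * G.cfv (G.combine (G.owner I) c σ) J :=
        Finset.sum_le_sum fun b hb =>
          mul_le_mul_of_nonneg_left (h.cfvAct_le_cfv hJ' hb) ((hc' J).1 b)
    _ = _ := by rw [← Finset.sum_mul, (hc' J).2.2, one_mul]

/-- The counterfactual best response values do not depend on the choice of the counterfactual best
response. This needs two actions at `I`: an information set with a single action leaves no trace in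
`reachOwn`, so that perfect recall does not make later information sets remember it. -/
theorem IsCBR.cfvAct_eq (G : EFGame A ι) (hr : G.PerfectRecall) {I : ι} {a : A}
    (hcard : 2 ≤ (G.act I).card) (ha : a ∈ G.act I) {σ c c' : ι → A → ℝ}
    (h : G.IsCBR (G.owner I) σ c) (h' : G.IsCBR (G.owner I) σ c') :
    G.cfvAct (G.combine (G.owner I) c σ) I a = G.cfvAct (G.combine (G.owner I) c' σ) I a :=
  le_antisymm (h'.cfvAct_le G hr hcard ha h.1) (h.cfvAct_le G hr hcard ha h'.1)

theorem IsCBR.cfv_le (G : EFGame A ι) (hr : G.PerfectRecall) {I : ι}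
    (hcard : 2 ≤ (G.act I).card) {σ c c' : ι → A → ℝ}
    (h : G.IsCBR (G.owner I) σ c) (hc' : G.IsProfile c') :
    G.cfv (G.combine (G.owner I) c' σ) I ≤ G.cfv (G.combine (G.owner I) c σ) I := by
  have hI : G.combine (G.owner I) c' σ I = c' I := if_pos rfl
  rw [cfv_eq_sum, hI, hc'.sum_mul_eq]
  calc _ ≤ ∑ b ∈ G.act I, c' I b * G.cfv (G.combine (G.owner I) c σ) I :=
        Finset.sum_le_sum fun b hb => mul_le_mul_of_nonneg_left
          ((h.cfvAct_le G hr hcard hb hc').trans (h.cfvAct_le_cfv rfl hb)) ((hc' I).1 b)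
    _ = _ := by rw [← Finset.sum_mul, (hc' I).2.2, one_mul]

theorem IsCBR.cfv_eq (G : EFGame A ι) (hr : G.PerfectRecall) {I : ι}
    (hcard : 2 ≤ (G.act I).card) {σ c c' : ι → A → ℝ}
    (h : G.IsCBR (G.owner I) σ c) (h' : G.IsCBR (G.owner I) σ c') :
    G.cfv (G.combine (G.owner I) c σ) I = G.cfv (G.combine (G.owner I) c' σ) I :=
  le_antisymm (h'.cfv_le G hr hcard h.1) (h.cfv_le G hr hcard h'.1)

theorem isCBR_cbr (G : EFGame A ι) (hr : G.PerfectRecall) (i : Fin 2) (σ : ι → A → ℝ) :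
    G.IsCBR i σ (G.cbr i σ) :=
  Classical.epsilon_spec (G.exists_isCBR hr i σ)

end EFGame

namespace EFGame

variable {A ι : Type*} [Fintype A] [DecidableEq A]

/-! ### Continuity and compactness -/

theorem continuous_pathProd {X : Type*} [TopologicalSpace X] {w : X → List A → A → ℝ}
    (hw : ∀ g b, Continuous fun x => w x g b) (s : List A) : ∀ g : List A,
    Continuous fun x => pathProd (w x) g s := by
  induction s with
  | nil => intro g; exact continuous_const
  | cons b s ih => intro g; exact (hw g b).mul (ih _)

theorem continuous_moveProb (G : EFGame A ι) (g : List A) (b : A) :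
    Continuous fun σ : ι → A → ℝ => G.moveProb σ g b := by
  unfold moveProb
  split
  · fun_prop
  · fun_prop

theorem continuous_otherProb (G : EFGame A ι) (i : Fin 2) (g : List A) (b : A) :
    Continuous fun σ : ι → A → ℝ => G.otherProb σ i g b := by
  unfold otherProb
  split
  · split_ifs <;> fun_prop
  · fun_prop

theorem continuous_nodeValue (G : EFGame A ι) (i : Fin 2) (g : List A) :
    Continuous fun σ : ι → A → ℝ => G.nodeValue i σ g := by
  refine continuous_finsetSum _ fun z _ => Continuous.mul ?_ continuous_const
  unfold reachFrom
  split_ifs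
  · exact continuous_pathProd G.continuous_moveProb _ _
  · exact continuous_const

theorem continuous_utility (G : EFGame A ι) (i : Fin 2) :
    Continuous fun σ : ι → A → ℝ => G.utility i σ := by
  simp only [utility_eq_nodeValue]
  exact G.continuous_nodeValue i []

theorem continuous_combine (G : EFGame A ι) (i : Fin 2) :
    Continuous fun p : (ι → A → ℝ) × (ι → A → ℝ) => G.combine i p.2 p.1 := by
  refine continuous_pi fun I => ?_
  unfold combine
  split_ifs <;> fun_prop

theorem isCompact_setOf_isProfile (G : EFGame A ι) : IsCompact {σ | G.IsProfile σ} := by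
  have hsub : {σ | G.IsProfile σ}
      ⊆ Set.univ.pi fun _ => Set.univ.pi fun _ => Set.Icc (0 : ℝ) 1 :=
    fun σ hσ I _ a _ => IsProfile.mem_Icc hσ I a
  refine (isCompact_univ_pi fun _ => isCompact_univ_pi fun _ => isCompact_Icc).of_isClosed_subset
    ?_ hsub
  simp only [IsProfile, Set.ofPred_forall, Set.ofPred_and]
  refine isClosed_iInter fun I => IsClosed.inter (isClosed_iInter fun a => ?_)
    (IsClosed.inter (isClosed_iInter fun a => isClosed_iInter fun _ => ?_) ?_)
  · exact isClosed_le continuous_const (by fun_prop)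
  · exact isClosed_eq (by fun_prop) continuous_const
  · exact isClosed_eq (by fun_prop) continuous_const

/-! ### Nash equilibria of zero-sum games -/

theorem combine_combine_left (G : EFGame A ι) (i : Fin 2) (τ σ : ι → A → ℝ) :
    G.combine i (G.combine i τ σ) σ = G.combine i τ σ := by
  funext I
  unfold combine
  split_ifs <;> rfl

theorem combine_opponent_combine (G : EFGame A ι) (i : Fin 2) (τ σ : ι → A → ℝ) :
    G.combine (opponent i) (G.combine i τ σ) σ = σ := by
  funext I
  unfold combine
  split_ifs with h1 h2
  · exfalso
    rw [h2] at h1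
    revert h1
    fin_cases i <;> simp [opponent]
  · rfl
  · rfl

theorem ZeroSum.utility_add (G : EFGame A ι) (hz : G.ZeroSum) (σ : ι → A → ℝ) :
    G.utility 0 σ + G.utility 1 σ = 0 := by
  rw [utility, utility, ← Finset.sum_add_distrib]
  refine Finset.sum_eq_zero fun z hz' => ?_
  rw [hz z hz']
  ring

/-- In a zero-sum game a profile is a Nash equilibrium if no pair of deviations, one for each
player, has positive total payoff. -/
theorem isNash_of_forall_utility_add_le (G : EFGame A ι) (hz : G.ZeroSum) {σ : ι → A → ℝ}
    (hσ : G.IsProfile σ)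
    (h : ∀ τ, G.IsProfile τ →
      G.utility 0 (G.combine 0 τ σ) + G.utility 1 (G.combine 1 τ σ) ≤ 0) : G.IsNash σ := by
  refine ⟨hσ, fun i τ hτ => ?_⟩
  have h1 := h _ (hτ.combine hσ i)
  have h2 := hz.utility_add G σ
  fin_cases i
  · have h3 := G.combine_opponent_combine 0 τ σ
    rw [show opponent 0 = 1 from rfl] at h3
    simp only [Fin.zero_eta, combine_combine_left, h3] at h1 ⊢
    linarith
  · have h3 := G.combine_opponent_combine 1 τ σ
    rw [show opponent 1 = 0 from rfl] at h3
    simp only [Fin.mk_one, combine_combine_left, h3] at h1 ⊢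
    linarith

/-- A strict inequality at all Nash equilibria holds with a margin at all approximate ones. The
second profile `c`, confined to a closed set `F`, allows for inequalities about best responses. -/
theorem exists_forall_le_neg_of_forall_isNash (G : EFGame A ι) (hz : G.ZeroSum)
    {F : Set ((ι → A → ℝ) × (ι → A → ℝ))} (hF : IsClosed F)
    {f : (ι → A → ℝ) × (ι → A → ℝ) → ℝ} (hf : Continuous f)
    (hneg : ∀ σ c, G.IsNash σ → G.IsProfile c → (σ, c) ∈ F → f (σ, c) < 0) :
    ∃ δ > 0, ∀ σ c, G.IsProfile σ → G.IsProfile c → (σ, c) ∈ F →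
      (∀ τ, G.IsProfile τ →
        G.utility 0 (G.combine 0 τ σ) + G.utility 1 (G.combine 1 τ σ) ≤ δ) →
      f (σ, c) ≤ -δ := by
  have := G.finite_infosets
  have := Fintype.ofFinite ι
  by_contra hcon
  push Not at hcon
  choose σ c hσ hc hmem hE hlt using fun n : ℕ =>
    hcon (1 / ((n : ℝ) + 1)) (by positivity)
  obtain ⟨⟨σ₀, c₀⟩, ⟨hσ₀, hc₀⟩, φ, hφ, hlim⟩ :=
    (G.isCompact_setOf_isProfile.prod G.isCompact_setOf_isProfile).tendsto_subseq
      (x := fun n => (σ n, c n)) (fun n => ⟨hσ n, hc n⟩)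
  have hδ : Filter.Tendsto (fun n => 1 / (((φ n : ℕ) : ℝ) + 1)) Filter.atTop (nhds 0) :=
    tendsto_one_div_add_atTop_nhds_zero_nat.comp hφ.tendsto_atTop
  have hmem₀ : (σ₀, c₀) ∈ F :=
    hF.mem_of_tendsto hlim (Filter.Eventually.of_forall fun n => hmem (φ n))
  have hnash : G.IsNash σ₀ := by
    refine G.isNash_of_forall_utility_add_le hz hσ₀ fun τ hτ => ?_
    have hcont : Continuous fun p : (ι → A → ℝ) × (ι → A → ℝ) =>
        G.utility 0 (G.combine 0 τ p.1) + G.utility 1 (G.combine 1 τ p.1) := by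
      have h1 : ∀ i, Continuous fun p : (ι → A → ℝ) × (ι → A → ℝ) =>
          G.utility i (G.combine i τ p.1) := fun i =>
        (G.continuous_utility i).comp ((G.continuous_combine i).comp
          (continuous_fst.prodMk continuous_const))
      exact (h1 0).add (h1 1)
    have h1 := (hcont.tendsto (σ₀, c₀)).comp hlim
    exact le_of_tendsto_of_tendsto h1 hδ
      (Filter.Eventually.of_forall fun n => hE (φ n) τ hτ)
  have h0 : 0 ≤ f (σ₀, c₀) := by
    have h1 := hδ.neg
    rw [neg_zero] at h1
    have h2 := (hf.tendsto (σ₀, c₀)).comp hlim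
    exact le_of_tendsto_of_tendsto h1 h2
      (Filter.Eventually.of_forall fun n => (hlt (φ n)).le)
  exact absurd (hneg σ₀ c₀ hnash hc₀ hmem₀) (not_lt.2 h0)

/-! ### The average strategy -/

variable [DecidableEq ι]

theorem isProfile_average {G : EFGame A ι} {σ : ℕ → ι → A → ℝ} (hσ : ∀ t, G.IsProfile (σ t))
    (T : ℕ) : G.IsProfile (G.average σ T) := by
  intro I
  by_cases h0 : ∑ t ∈ Finset.Icc 1 T, G.reachInfo (σ t) I = 0
  · have h1 : G.average σ T I = G.uniformProfile I := by
      funext a; rw [average, if_pos h0]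
    rw [h1]
    exact G.isProfile_uniformProfile I
  · have h1 : ∀ a, G.average σ T I a = (∑ t ∈ Finset.Icc 1 T, G.reachInfo (σ t) I * σ t I a) /
        ∑ t ∈ Finset.Icc 1 T, G.reachInfo (σ t) I := fun a => by rw [average, if_neg h0]
    have hr : ∀ t, 0 ≤ G.reachInfo (σ t) I := fun t => (reachOwn_mem_Icc (hσ t) _ _).1
    simp only [h1]
    refine ⟨fun a => ?_, fun a ha => ?_, ?_⟩
    · exact div_nonneg (Finset.sum_nonneg fun t _ => mul_nonneg (hr t) ((hσ t I).1 a))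
        (Finset.sum_nonneg fun t _ => hr t)
    · simp [(hσ _ I).2.1 a ha]
    · rw [← Finset.sum_div, Finset.sum_comm]
      simp only [← Finset.mul_sum, (hσ _ I).2.2, mul_one]
      exact div_self h0

/-- The average strategy reaches every history with the mean of the probabilities with which
the single iterations reach it. -/
theorem natCast_mul_reachOwn_average {G : EFGame A ι} (hr : G.PerfectRecall)
    {σ : ℕ → ι → A → ℝ} (hσ : ∀ t, G.IsProfile (σ t)) (T : ℕ) (j : Fin 2) (h : List A) :
    T * G.reachOwn (G.average σ T) j h = ∑ t ∈ Finset.Icc 1 T, G.reachOwn (σ t) j h := by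
  induction h using List.reverseRecOn with
  | nil => simp [reachOwn, pathProd]
  | append_singleton h b ih =>
    have hstep : ∀ ρ : ι → A → ℝ,
        G.reachOwn ρ j (h ++ [b]) = G.reachOwn ρ j h * G.ownProb ρ j h b := by
      intro ρ
      rw [reachOwn, pathProd_append]
      simp [pathProd, reachOwn]
    simp only [hstep]
    rw [← mul_assoc, ih]
    unfold ownProb
    split
    · rename_i J hJ
      split_ifs with ho
      · subst ho
        simp only [← G.reachInfo_eq hr _ (hσ _) J h hJ]
        by_cases h0 : ∑ t ∈ Finset.Icc 1 T, G.reachInfo (σ t) J = 0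
        · rw [h0, zero_mul, eq_comm]
          refine Finset.sum_eq_zero fun t ht => ?_
          have hz : G.reachInfo (σ t) J = 0 := (Finset.sum_eq_zero_iff_of_nonneg
            fun t _ => (reachOwn_mem_Icc (hσ t) _ _).1).1 h0 t ht
          rw [hz, zero_mul]
        · rw [average, if_neg h0, mul_div_cancel₀ _ h0]
      · simp
    · simp

/-- The contribution of everybody but player `i` is that of chance, written here as
`otherProb` of the constant weight `1`, times that of the opponent. -/
theorem reachOther_eq_mul_reachOwn (G : EFGame A ι) (σ : ι → A → ℝ) (i : Fin 2) (h : List A) :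
    G.reachOther σ i h
      = pathProd (fun g b => G.otherProb (fun _ _ => 1) i g b) [] h *
        G.reachOwn σ (opponent i) h := by
  rw [reachOwn, ← pathProd_mul, reachOther]
  congr 1
  funext g b
  unfold otherProb ownProb
  split
  · rename_i J _
    have hfin : ∀ k l : Fin 2, k = opponent l ↔ ¬ k = l := by decide
    by_cases h1 : G.owner J = i
    · rw [if_pos h1, if_pos h1, if_neg (by rw [hfin]; exact not_not.2 h1), one_mul]
    · rw [if_neg h1, if_neg h1, if_pos ((hfin _ _).2 h1), one_mul]
  · simp

theorem natCast_mul_reachOther_average {G : EFGame A ι} (hr : G.PerfectRecall)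
    {σ : ℕ → ι → A → ℝ} (hσ : ∀ t, G.IsProfile (σ t)) (T : ℕ) (i : Fin 2) (h : List A) :
    T * G.reachOther (G.average σ T) i h = ∑ t ∈ Finset.Icc 1 T, G.reachOther (σ t) i h := by
  simp only [reachOther_eq_mul_reachOwn]
  rw [← Finset.mul_sum, ← natCast_mul_reachOwn_average hr hσ]
  ring

theorem reachOther_mul_nodeValue_combine (G : EFGame A ι) (i : Fin 2) (c σ : ι → A → ℝ)
    (g : List A) :
    G.reachOther σ i g * G.nodeValue i (G.combine i c σ) g
      = ∑ z ∈ G.terminals, G.ownFrom c i g z * G.payoff i z * G.reachOther σ i z := by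
  rw [nodeValue, Finset.mul_sum]
  refine Finset.sum_congr rfl fun z _ => ?_
  rw [← mul_assoc, reachOther_mul_reachFrom]
  ring

/-- Against the average strategy of the opponent, a fixed strategy obtains the mean of the values
it obtains in the single iterations. -/
theorem natCast_mul_reachOther_mul_nodeValue_average {G : EFGame A ι} (hr : G.PerfectRecall)
    {σ : ℕ → ι → A → ℝ} (hσ : ∀ t, G.IsProfile (σ t)) (T : ℕ) (i : Fin 2) (c : ι → A → ℝ)
    (g : List A) :
    T * (G.reachOther (G.average σ T) i g * G.nodeValue i (G.combine i c (G.average σ T)) g)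
      = ∑ t ∈ Finset.Icc 1 T, G.reachOther (σ t) i g * G.nodeValue i (G.combine i c (σ t)) g := by
  simp only [reachOther_mul_nodeValue_combine]
  rw [Finset.mul_sum, Finset.sum_comm]
  refine Finset.sum_congr rfl fun z _ => ?_
  rw [← Finset.mul_sum, ← natCast_mul_reachOther_average hr hσ]
  ring

theorem natCast_mul_utility_average {G : EFGame A ι} (hr : G.PerfectRecall)
    {σ : ℕ → ι → A → ℝ} (hσ : ∀ t, G.IsProfile (σ t)) (T : ℕ) (i : Fin 2) (c : ι → A → ℝ) :
    T * G.utility i (G.combine i c (G.average σ T))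
      = ∑ t ∈ Finset.Icc 1 T, G.utility i (G.combine i c (σ t)) := by
  simpa [reachOther, pathProd, utility_eq_nodeValue] using
    natCast_mul_reachOther_mul_nodeValue_average hr hσ T i c []

theorem natCast_mul_cfv_average {G : EFGame A ι} (hr : G.PerfectRecall)
    {σ : ℕ → ι → A → ℝ} (hσ : ∀ t, G.IsProfile (σ t)) (T : ℕ) (I : ι) (c : ι → A → ℝ) :
    T * G.cfv (G.combine (G.owner I) c (G.average σ T)) I
      = ∑ t ∈ Finset.Icc 1 T, G.cfv (G.combine (G.owner I) c (σ t)) I := by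
  have h1 : ∀ ρ, G.cfv (G.combine (G.owner I) c ρ) I = ∑ h ∈ G.nodes I,
      G.reachOther ρ (G.owner I) h *
        G.nodeValue (G.owner I) (G.combine (G.owner I) c ρ) h := by
    intro ρ
    refine Finset.sum_congr rfl fun h _ => ?_
    rw [reachOther_combine]
    rfl
  simp only [h1]
  rw [Finset.mul_sum, Finset.sum_comm]
  exact Finset.sum_congr rfl fun h _ => natCast_mul_reachOther_mul_nodeValue_average hr hσ T _ c h

/-! ### Continuity of counterfactual values -/

theorem continuous_cfvAct (G : EFGame A ι) (I : ι) (a : A) :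
    Continuous fun σ : ι → A → ℝ => G.cfvAct σ I a := by
  simp only [cfvAct_eq]
  refine continuous_finsetSum _ fun h _ => Continuous.mul ?_ (G.continuous_nodeValue _ _)
  exact continuous_pathProd (G.continuous_otherProb _) _ _

theorem continuous_cfv (G : EFGame A ι) (I : ι) :
    Continuous fun σ : ι → A → ℝ => G.cfv σ I := by
  simp only [cfv_eq_sum]
  exact continuous_finsetSum _ fun b _ => Continuous.mul (by fun_prop) (G.continuous_cfvAct I b)

theorem isClosed_setOf_isCBR (G : EFGame A ι) (i : Fin 2) :
    IsClosed {p : (ι → A → ℝ) × (ι → A → ℝ) | G.IsCBR i p.1 p.2} := by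
  have hcont : ∀ I a, Continuous fun p : (ι → A → ℝ) × (ι → A → ℝ) =>
      G.cfvAct (G.combine i p.2 p.1) I a := fun I a =>
    (G.continuous_cfvAct I a).comp (G.continuous_combine i)
  simp only [IsCBR, Set.ofPred_and, Set.ofPred_forall]
  refine IsClosed.inter (G.isCompact_setOf_isProfile.isClosed.preimage continuous_snd) ?_
  refine isClosed_iInter fun I => isClosed_iInter fun _ => isClosed_iInter fun a =>
    isClosed_iInter fun _ => ?_
  refine isClosed_imp ?_ ?_
  · exact isOpen_lt continuous_const (by fun_prop)
  · simp only [Set.ofPred_forall]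
    exact isClosed_iInter fun a' => isClosed_iInter fun _ => isClosed_le (hcont I a') (hcont I a)

/-! ### Regret matching -/

theorem isProfile_regretMatching (G : EFGame A ι) (R : ι → A → ℝ) :
    G.IsProfile (G.regretMatching R) := by
  intro I
  have hm : ∀ b, 0 ≤ max (R I b) 0 := fun b => le_max_right _ _
  have hcard : (0 : ℝ) < (G.act I).card := by exact_mod_cast (G.act_nonempty I).card_pos
  refine ⟨fun a => ?_, fun a ha => by rw [regretMatching, if_neg ha], ?_⟩
  · unfold regretMatching
    split_ifs with h1 h2
    · exact div_nonneg (hm a) h2.le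
    · positivity
    · exact le_rfl
  · by_cases h : 0 < ∑ b ∈ G.act I, max (R I b) 0
    · rw [Finset.sum_congr rfl fun a ha => by rw [regretMatching, if_pos ha, if_pos h],
        ← Finset.sum_div, div_self h.ne']
    · rw [Finset.sum_congr rfl fun a ha => by rw [regretMatching, if_pos ha, if_neg h]]
      simp [hcard.ne']

theorem isProfile_cfr (G : EFGame A ι) (t : ℕ) : G.IsProfile (G.cfr t) :=
  G.isProfile_regretMatching _

theorem cfrRegret_eq_sum (G : EFGame A ι) (T : ℕ) (I : ι) (a : A) :
    G.cfrRegret T I a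
      = ∑ t ∈ Finset.Icc 1 T, (G.cfvAct (G.cfr t) I a - G.cfv (G.cfr t) I) := by
  induction T with
  | zero => simp [cfrRegret]
  | succ T ih =>
    rw [Finset.sum_Icc_succ_top (by omega), ← ih]
    rfl

/-- Regret matching makes the positive regrets orthogonal to the next instantaneous regrets. -/
theorem sum_max_mul_regretMatching_eq_zero (G : EFGame A ι) (R : ι → A → ℝ) (I : ι) :
    ∑ b ∈ G.act I, max (R I b) 0 *
      (G.cfvAct (G.regretMatching R) I b - G.cfv (G.regretMatching R) I) = 0 := by
  have hp := G.isProfile_regretMatching R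
  by_cases h : 0 < ∑ b ∈ G.act I, max (R I b) 0
  · have h1 : ∀ b ∈ G.act I, max (R I b) 0
        = (∑ b ∈ G.act I, max (R I b) 0) * G.regretMatching R I b := by
      intro b hb
      rw [regretMatching, if_pos hb, if_pos h, mul_div_cancel₀ _ h.ne']
    rw [Finset.sum_congr rfl fun b hb => by rw [h1 b hb, mul_assoc], ← Finset.mul_sum]
    simp only [mul_sub, Finset.sum_sub_distrib]
    rw [← Finset.sum_mul, (hp I).2.2, one_mul, ← hp.sum_mul_eq, ← cfv_eq_sum, sub_self]
  · have h0 := le_antisymm (not_lt.1 h) (Finset.sum_nonneg fun b _ => le_max_right _ _)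
    rw [Finset.sum_eq_zero_iff_of_nonneg fun b _ => le_max_right _ _] at h0
    exact Finset.sum_eq_zero fun b hb => by rw [h0 b hb, zero_mul]

theorem sq_max_add_le (x y : ℝ) :
    max (x + y) 0 ^ 2 ≤ max x 0 ^ 2 + 2 * (max x 0 * y) + y ^ 2 := by
  have h1 : max x 0 ^ 2 + 2 * (max x 0 * y) + y ^ 2 = (max x 0 + y) ^ 2 := by ring
  rw [h1]
  rcases le_total (x + y) 0 with h | h
  · rw [max_eq_right h, zero_pow two_ne_zero]; exact sq_nonneg _
  · rw [max_eq_left h]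
    exact pow_le_pow_left₀ h (by linarith [le_max_left x 0]) 2

/-- Every cumulative regret grows at most like the square root of the number of iterations: the sum
of the squared positive regrets at an information set grows by at most a constant per iteration. -/
theorem exists_cfrRegret_le (G : EFGame A ι) :
    ∃ M : ℝ, 0 ≤ M ∧ ∀ T I, ∀ a ∈ G.act I, G.cfrRegret T I a ≤ M * √T := by
  have := G.finite_infosets
  have := Fintype.ofFinite ι
  obtain ⟨D, hD⟩ := G.isCompact_setOf_isProfile.exists_bound_of_continuousOn
    (f := fun σ => fun (I : ι) (a : A) => G.cfvAct σ I a - G.cfv σ I)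
    (continuous_pi fun I => continuous_pi fun a =>
      (G.continuous_cfvAct I a).sub (G.continuous_cfv I)).continuousOn
  have hD' : ∀ σ, G.IsProfile σ → ∀ I a, (G.cfvAct σ I a - G.cfv σ I) ^ 2 ≤ D ^ 2 := by
    intro σ hσ I a
    refine sq_le_sq' ?_ ?_
    all_goals
      have h1 := ((norm_le_pi_norm _ a).trans (norm_le_pi_norm
        (fun (I : ι) (a : A) => G.cfvAct σ I a - G.cfv σ I) I)).trans (hD σ hσ)
      have h2 := abs_le.1 h1
    · exact h2.1
    · exact h2.2
  have hpot : ∀ T I, ∑ a ∈ G.act I, max (G.cfrRegret T I a) 0 ^ 2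
      ≤ T * (Fintype.card A * D ^ 2) := by
    intro T I
    induction T with
    | zero => simp [cfrRegret]
    | succ T ih =>
      have hp := G.isProfile_regretMatching (G.cfrRegret T)
      calc ∑ a ∈ G.act I, max (G.cfrRegret (T + 1) I a) 0 ^ 2
          ≤ ∑ a ∈ G.act I, (max (G.cfrRegret T I a) 0 ^ 2 + 2 * (max (G.cfrRegret T I a) 0 *
            (G.cfvAct (G.regretMatching (G.cfrRegret T)) I a
              - G.cfv (G.regretMatching (G.cfrRegret T)) I)) + D ^ 2) :=
            Finset.sum_le_sum fun a _ =>
              (sq_max_add_le _ _).trans (add_le_add le_rfl (hD' _ hp I a))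
        _ = ∑ a ∈ G.act I, max (G.cfrRegret T I a) 0 ^ 2 + (G.act I).card * D ^ 2 := by
            rw [Finset.sum_add_distrib, Finset.sum_add_distrib, ← Finset.mul_sum,
              sum_max_mul_regretMatching_eq_zero]
            simp
        _ ≤ T * (Fintype.card A * D ^ 2) + Fintype.card A * D ^ 2 := by
            refine add_le_add ih (mul_le_mul_of_nonneg_right ?_ (sq_nonneg D))
            exact_mod_cast Finset.card_le_univ (G.act I)
        _ = _ := by push_cast; ring
  refine ⟨√(Fintype.card A * D ^ 2), Real.sqrt_nonneg _, fun T I a ha => ?_⟩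
  rw [← Real.sqrt_mul (by positivity), mul_comm]
  refine (le_max_left _ 0).trans (Real.le_sqrt_of_sq_le ?_)
  exact (Finset.single_le_sum (f := fun a => max (G.cfrRegret T I a) 0 ^ 2)
    (fun a _ => sq_nonneg _) ha).trans (hpot T I)

theorem sum_cfr_sub_mul_cfvAct_le (G : EFGame A ι) {M : ℝ}
    (hM : ∀ T I, ∀ a ∈ G.act I, G.cfrRegret T I a ≤ M * √T) (T : ℕ) (J : ι) {c : ι → A → ℝ}
    (hc : G.IsProfile c) :
    ∑ t ∈ Finset.Icc 1 T, ∑ b, (c J b - G.cfr t J b) * G.cfvAct (G.cfr t) J b ≤ M * √T := by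
  have h1 : ∀ t, ∑ b, (c J b - G.cfr t J b) * G.cfvAct (G.cfr t) J b
      = ∑ b, c J b * (G.cfvAct (G.cfr t) J b - G.cfv (G.cfr t) J) := by
    intro t
    simp only [sub_mul, mul_sub, Finset.sum_sub_distrib]
    rw [← cfv_eq_sum, ← Finset.sum_mul, hc.sum_eq_one, one_mul]
  simp only [h1]
  rw [Finset.sum_comm]
  simp only [← Finset.mul_sum, ← cfrRegret_eq_sum]
  rw [hc.sum_mul_eq]
  calc _ ≤ ∑ b ∈ G.act J, c J b * (M * √T) :=
        Finset.sum_le_sum fun b hb => mul_le_mul_of_nonneg_left (hM T J b hb) ((hc J).1 b)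
    _ = _ := by rw [← Finset.sum_mul, (hc J).2.2, one_mul]

theorem sum_weighted_cfr_sub_mul_cfvAct_le [Fintype ι] (G : EFGame A ι) {M N : ℝ} (hM0 : 0 ≤ M)
    (hM : ∀ T I, ∀ a ∈ G.act I, G.cfrRegret T I a ≤ M * √T) (T : ℕ) (i : Fin 2) {c : ι → A → ℝ}
    (hc : G.IsProfile c) {ω : ι → ℝ} (hω : ∀ J, ω J ∈ Set.Icc 0 N) :
    ∑ t ∈ Finset.Icc 1 T, ∑ J with G.owner J = i, ω J *
      ∑ b, (c J b - G.cfr t J b) * G.cfvAct (G.cfr t) J b ≤ Fintype.card ι * (N * M) * √T := by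
  rw [Finset.sum_comm]
  simp only [← Finset.mul_sum]
  calc _ ≤ ∑ J with G.owner J = i, N * (M * √T) := by
        refine Finset.sum_le_sum fun J _ => ?_
        exact (mul_le_mul_of_nonneg_left (G.sum_cfr_sub_mul_cfvAct_le hM T J hc) (hω J).1).trans
          (mul_le_mul_of_nonneg_right (hω J).2 (by positivity))
    _ ≤ ∑ J : ι, N * (M * √T) := by
        refine Finset.sum_le_sum_of_subset_of_nonneg (Finset.filter_subset _ _) fun J _ _ => ?_
        have := (hω J).1.trans (hω J).2
        positivity
    _ = _ := by simp only [Finset.sum_const, nsmul_eq_mul, Finset.card_univ]; ring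

/-- CFR has sublinear regret for the payoff of the whole game. -/
theorem exists_sum_utility_sub_le (G : EFGame A ι) (hr : G.PerfectRecall) :
    ∃ C : ℝ, ∀ T i c, G.IsProfile c →
      ∑ t ∈ Finset.Icc 1 T, (G.utility i (G.combine i c (G.cfr t)) - G.utility i (G.cfr t))
        ≤ C * √T := by
  have := G.finite_infosets
  have := Fintype.ofFinite ι
  obtain ⟨M, hM0, hM⟩ := G.exists_cfrRegret_le
  refine ⟨Fintype.card ι * (1 * M), fun T i c hc => ?_⟩
  simp only [G.utility_combine_sub_eq hr i hc]
  exact G.sum_weighted_cfr_sub_mul_cfvAct_le hM0 hM T i hc (N := 1)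
    fun J => reachOwn_mem_Icc hc _ _

/-- CFR has sublinear regret for the counterfactual value of an information set. -/
theorem exists_sum_cfv_sub_le (G : EFGame A ι) (hr : G.PerfectRecall) {I : ι}
    (hcard : 2 ≤ (G.act I).card) :
    ∃ C : ℝ, ∀ T c, G.IsProfile c →
      ∑ t ∈ Finset.Icc 1 T, (G.cfv (G.combine (G.owner I) c (G.cfr t)) I - G.cfv (G.cfr t) I)
        ≤ C * √T := by
  have := G.finite_infosets
  have := Fintype.ofFinite ι
  obtain ⟨M, hM0, hM⟩ := G.exists_cfrRegret_le
  set K : ℝ := Fintype.card ι * ((G.nodes I).card * M)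
  refine ⟨K + M, fun T c hc => ?_⟩
  have hI : ∀ σ, G.combine (G.owner I) c σ I = c I := fun σ => if_pos rfl
  have hsplit : ∀ t, G.cfv (G.combine (G.owner I) c (G.cfr t)) I - G.cfv (G.cfr t) I
      = ∑ b, c I b * (G.cfvAct (G.combine (G.owner I) c (G.cfr t)) I b - G.cfvAct (G.cfr t) I b)
        + ∑ b, (c I b - G.cfr t I b) * G.cfvAct (G.cfr t) I b := by
    intro t
    rw [cfv_eq_sum, cfv_eq_sum, hI, ← Finset.sum_sub_distrib, ← Finset.sum_add_distrib]
    exact Finset.sum_congr rfl fun b _ => by ring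
  have hact : ∀ b ∈ G.act I, ∑ t ∈ Finset.Icc 1 T,
      (G.cfvAct (G.combine (G.owner I) c (G.cfr t)) I b - G.cfvAct (G.cfr t) I b)
        ≤ K * √T := by
    intro b hb
    obtain ⟨ω, hω, hpd⟩ := G.exists_cfvAct_combine_sub_eq hr hcard hb hc
    simp only [hpd]
    exact G.sum_weighted_cfr_sub_mul_cfvAct_le hM0 hM T _ hc hω
  simp only [hsplit, Finset.sum_add_distrib, add_mul]
  refine add_le_add ?_ (G.sum_cfr_sub_mul_cfvAct_le hM T I hc)
  rw [Finset.sum_comm]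
  simp only [← Finset.mul_sum]
  rw [hc.sum_mul_eq]
  calc _ ≤ ∑ b ∈ G.act I, c I b * (K * √T) :=
        Finset.sum_le_sum fun b hb => mul_le_mul_of_nonneg_left (hact b hb) ((hc I).1 b)
    _ = _ := by rw [← Finset.sum_mul, (hc I).2.2, one_mul]

/-! ### Convergence and pruning -/

theorem eventually_mul_sqrt_le (C : ℝ) {ε : ℝ} (hε : 0 < ε) :
    ∀ᶠ T : ℕ in Filter.atTop, C * √T ≤ T * ε := by
  have h1 : Filter.Tendsto (fun T : ℕ => √(T : ℝ) * ε) Filter.atTop Filter.atTop :=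
    (Real.tendsto_sqrt_atTop.comp tendsto_natCast_atTop_atTop).atTop_mul_const hε
  filter_upwards [h1.eventually_ge_atTop C] with T hT
  have h2 := mul_le_mul_of_nonneg_right hT (Real.sqrt_nonneg (T : ℝ))
  have h3 := Real.mul_self_sqrt (Nat.cast_nonneg (α := ℝ) T)
  calc C * √T ≤ √T * ε * √T := h2
    _ = (√T * √T) * ε := by ring
    _ = T * ε := by rw [h3]

/-- In a zero-sum game the average CFR profiles are approximate Nash equilibria. -/
theorem eventually_utility_add_le (G : EFGame A ι) (hz : G.ZeroSum) (hr : G.PerfectRecall)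
    {ε : ℝ} (hε : 0 < ε) :
    ∀ᶠ T : ℕ in Filter.atTop, ∀ τ, G.IsProfile τ →
      G.utility 0 (G.combine 0 τ (G.average G.cfr T))
        + G.utility 1 (G.combine 1 τ (G.average G.cfr T)) ≤ ε := by
  obtain ⟨C, hC⟩ := G.exists_sum_utility_sub_le hr
  filter_upwards [eventually_mul_sqrt_le (2 * C) hε, Filter.eventually_gt_atTop 0]
    with T hT hT0 τ hτ
  have hT0' : (0 : ℝ) < T := by exact_mod_cast hT0
  refine le_of_mul_le_mul_left ?_ hT0'
  rw [mul_add, natCast_mul_utility_average hr G.isProfile_cfr,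
    natCast_mul_utility_average hr G.isProfile_cfr]
  have h0 := hC T 0 τ hτ
  have h1 := hC T 1 τ hτ
  have h2 : ∑ t ∈ Finset.Icc 1 T, G.utility 0 (G.cfr t)
      + ∑ t ∈ Finset.Icc 1 T, G.utility 1 (G.cfr t) = 0 := by
    rw [← Finset.sum_add_distrib]
    exact Finset.sum_eq_zero fun t _ => hz.utility_add G _
  rw [Finset.sum_sub_distrib] at h0 h1
  linarith

/-- A zero-sum game has a Nash equilibrium: otherwise every approximate equilibrium would satisfy the
absurd inequality `0 ≤ -δ`, and the average CFR profiles are approximate equilibria. -/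
theorem exists_isNash (G : EFGame A ι) (hz : G.ZeroSum) (hr : G.PerfectRecall) :
    ∃ σ, G.IsNash σ := by
  by_contra hno
  push Not at hno
  obtain ⟨δ, hδ, h⟩ := G.exists_forall_le_neg_of_forall_isNash hz isClosed_univ
    (f := fun _ => 0) continuous_const fun σ _ hσ => absurd hσ (hno σ)
  obtain ⟨T, hT⟩ := (G.eventually_utility_add_le hz hr hδ).exists
  have hp := isProfile_average G.isProfile_cfr T
  linarith [h _ _ hp hp (Set.mem_univ _) hT]

theorem IsCBR.isNearCBR {G : EFGame A ι} {i : Fin 2} {σ c : ι → A → ℝ} (h : G.IsCBR i σ c)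
    {x : ι → ℝ} (hx : ∀ J, 0 ≤ x J) (T : ℕ) : G.IsNearCBR x T i σ c := by
  refine ⟨h.1, fun J hJ => ?_⟩
  rw [Finset.sum_eq_zero]
  · exact div_nonneg (hx J) (sq_nonneg _)
  · intro b hb
    rw [max_eq_right (sub_nonpos.2 (h.cfvAct_le_cfv hJ hb))]
    simp

theorem nbvAct_le_cbvAct (G : EFGame A ι) (hr : G.PerfectRecall) {x : ι → ℝ}
    (hx : ∀ J, 0 ≤ x J) (T : ℕ) {σ : ι → A → ℝ} (hσ : G.IsProfile σ) (I : ι) (a : A) :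
    G.nbvAct x T σ I a ≤ G.cbvAct σ I a := by
  refine csInf_le ?_ ⟨_, (G.isCBR_cbr hr (G.owner I) σ).isNearCBR hx T, rfl⟩
  obtain ⟨D, hD⟩ := G.isCompact_setOf_isProfile.exists_bound_of_continuousOn
    (G.continuous_cfvAct I a).continuousOn
  refine ⟨-D, ?_⟩
  rintro y ⟨c, hc, rfl⟩
  exact (abs_le.1 (hD _ (hc.1.combine hσ (G.owner I)))).1

end EFGame

theorem theorem2 {A ι : Type*} [Fintype A] [DecidableEq A] [DecidableEq ι]
    (G : EFGame A ι) (hzero : G.ZeroSum) (hrecall : G.PerfectRecall)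
    (I : ι) (a : A) (ha : a ∈ G.act I)
    (hbad : ∀ σ, G.IsProfile σ → G.IsNashStrategy (EFGame.opponent (G.owner I)) σ →
      G.cbvAct σ I a < G.cbv σ I) :
    ∃ (T₀ : ℕ) (δ : ℝ), 0 < δ ∧ ∀ T : ℕ, T₀ ≤ T →
      G.cbvAct (G.average G.cfr T) I a
          - (∑ t ∈ Finset.Icc 1 T, G.cfv (G.cfr t) I) / (T : ℝ) ≤ -δ ∧
      ∀ x : ι → ℝ, (∀ J, 0 ≤ x J) →
        (T : ℝ) * G.nbvAct x T (G.average G.cfr T) I a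
          ≤ ∑ t ∈ Finset.Icc 1 T, G.cfv (G.cfr t) I := by
  have hnash : ∀ σ, G.IsNash σ → G.cbvAct σ I a < G.cbv σ I := fun σ hσ =>
    hbad σ hσ.1 ⟨σ, hσ, fun _ _ => rfl⟩
  have hcard : 2 ≤ (G.act I).card := by
    -- With a single action `cbvAct` and `cbv` agree, and a Nash equilibrium exists.
    by_contra hlt
    obtain ⟨σ, hσ⟩ := G.exists_isNash hzero hrecall
    have hc := G.isCBR_cbr hrecall (G.owner I) σ
    have hact : G.act I = {a} := by
      refine Finset.eq_singleton_iff_unique_mem.2 ⟨ha, fun b hb => ?_⟩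
      exact Finset.card_le_one.1 (by omega) b hb a ha
    have h1 : G.cbv σ I = G.cbvAct σ I a := by
      have hI : G.combine (G.owner I) (G.cbr (G.owner I) σ) σ I = G.cbr (G.owner I) σ I :=
        if_pos rfl
      have h2 := (hc.1 I).2.2
      rw [EFGame.cbv, EFGame.cfv_eq_sum, hI, hc.1.sum_mul_eq, hact, Finset.sum_singleton]
      rw [hact, Finset.sum_singleton] at h2
      rw [h2, one_mul, EFGame.cbvAct]
    exact absurd (hnash σ hσ) (by rw [h1]; exact lt_irrefl _)
  obtain ⟨δ, hδ, hgap⟩ := G.exists_forall_le_neg_of_forall_isNash hzero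
    (G.isClosed_setOf_isCBR (G.owner I))
    (f := fun p => G.cfvAct (G.combine (G.owner I) p.2 p.1) I a
      - G.cfv (G.combine (G.owner I) p.2 p.1) I)
    (((G.continuous_cfvAct I a).comp (G.continuous_combine _)).sub
      ((G.continuous_cfv I).comp (G.continuous_combine _)))
    (fun σ c hσ _ hc => by
      have h1 := hnash σ hσ
      have h2 := G.isCBR_cbr hrecall (G.owner I) σ
      rw [EFGame.cbv, EFGame.cbvAct, h2.cfvAct_eq G hrecall hcard ha hc,
        h2.cfv_eq G hrecall hcard hc] at h1
      exact sub_neg.2 h1)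
  obtain ⟨C, hC⟩ := G.exists_sum_cfv_sub_le hrecall hcard
  obtain ⟨T₀, hT₀⟩ := Filter.eventually_atTop.1
    ((G.eventually_utility_add_le hzero hrecall hδ).and
      ((EFGame.eventually_mul_sqrt_le C (half_pos hδ)).and (Filter.eventually_gt_atTop 0)))
  refine ⟨T₀, δ / 2, half_pos hδ, fun T hT => ?_⟩
  obtain ⟨hE, hCT, hT0⟩ := hT₀ T hT
  have hT0' : (0 : ℝ) < T := by exact_mod_cast hT0
  have hp := EFGame.isProfile_average G.isProfile_cfr T
  have hcbr := G.isCBR_cbr hrecall (G.owner I) (G.average G.cfr T)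
  have h1 : G.cbvAct (G.average G.cfr T) I a - G.cbv (G.average G.cfr T) I ≤ -δ :=
    hgap _ _ hp hcbr.1 hcbr hE
  have h2 : T * G.cbv (G.average G.cfr T) I
      ≤ ∑ t ∈ Finset.Icc 1 T, G.cfv (G.cfr t) I + T * (δ / 2) := by
    have h3 := hC T _ hcbr.1
    rw [Finset.sum_sub_distrib, ← EFGame.natCast_mul_cfv_average hrecall G.isProfile_cfr] at h3
    rw [EFGame.cbv]
    linarith
  have h4 : T * G.cbvAct (G.average G.cfr T) I a
      ≤ ∑ t ∈ Finset.Icc 1 T, G.cfv (G.cfr t) I - T * (δ / 2) := by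
    have := mul_le_mul_of_nonneg_left h1 hT0'.le
    linarith
  refine ⟨?_, fun x hx => ?_⟩
  · have h5 : G.cbvAct (G.average G.cfr T) I a
        ≤ (∑ t ∈ Finset.Icc 1 T, G.cfv (G.cfr t) I - T * (δ / 2)) / T := by
      rw [le_div_iff₀ hT0', mul_comm]
      exact h4
    rw [sub_div, mul_div_cancel_left₀ _ hT0'.ne'] at h5
    linarith
  · have h5 := mul_le_mul_of_nonneg_left (G.nbvAct_le_cbvAct hrecall hx T hp I a) hT0'.le
    have h6 : 0 < T * (δ / 2) := by positivity
    linarith
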